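/- Let $\Phi$ be the standard normal distribution function, $Q=\left(\Phi^{-1}(3/4)\right)^2$ and $A=\dfrac{\pi e^{Q}}{2Q}$; then $|A-5.4418|<5\cdot 10^{-5}$. There is a sequence $(V_N)_{N\ge 1}$ of real numbers, depending on nothing but $N$, with $$V_N\sim\frac{A}{N}=\frac{\pi e^{Q}}{2NQ}\qquad(N\to\infty),\quad\text{that is, } N V_N\to A\approx 5.4418,$$ such that the following holds. Let $0<H<1$, and let $\psi:\mathbb R\to\mathbb R$ be a wavelet, that is, $\int_{\mathbb R}(1+|t|^H)|\psi(t)|\,dt<\infty$ and $\int_{\mathbb R}\psi(t)\,dt=0$. For a process $B_H$ that is a fractional Brownian motion with Hurst exponent $H$ (a centred Gaussian process on $\mathbb R$ with almost surely continuous paths and covariance $\frac v2\left(|s|^{2H}+|t|^{2H}-|s-t|^{2H}\right)$), its nondecimated wavelet coefficient at level $j\in\mathbb Z$ and location $k\in\mathbb R$ is $$d_{jk}=\int_{\mathbb R}B_H(t)\,2^{j/2}\psi\!\left(2^{j}(t-k)\right)dt .$$ Let $\sigma^2>0$ be the variance of such a coefficient at level $0$. Let $d_1,\dots,d_N$ ($N\ge1$)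 be independent random variables, each of which is a nondecimated wavelet coefficient, at the same level $j$ and at any location, of a fractional Brownian motion with these $H$, $v$ (of a single one or of several ones). Let $\hat y_j^*$ be the sample median of $\log d_1^2,\dots,\log d_N^2$ (the middle order statistic if $N$ is odd, the average of the two middle ones if $N$ is even). Then $\hat y_j^*$ is square integrable and $$\operatorname{Var}(\hat y_j^*)=V_N .$$ So the variance of the sample median is approximately $\pi e^Q/(2NQ)\approx 5.4418/N$, and it is exactly the same for all levels $j$, all $H$ and all $\sigma^2$: the logarithm stabilizes the variance, and the homoscedasticity on which ordinary least squares regression of $\hat y_j^*$ on $j$ rests is satisfied. -/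

import Mathlib

open MeasureTheory ProbabilityTheory Filter Topology

noncomputable section

/-- `B` is a (two-sided) fractional Brownian motion with Hurst exponent `H` and scale `v` under
`P`: a centred Gaussian process with almost surely continuous paths and covariance
`(v / 2) * (|s| ^ (2H) + |t| ^ (2H) - |s - t| ^ (2H))`; thus `v` is the variance of `B 1`. -/
structure IsFractionalBrownianMotion {Ω : Type*} [MeasurableSpace Ω]
    (H v : ℝ) (B : ℝ → Ω → ℝ) (P : Measure Ω) : Prop where
  isGaussianProcess : IsGaussianProcess B P
  mean_eq_zero : ∀ t, ∫ ω, B t ω ∂P = 0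
  covariance_eq : ∀ s t, cov[B s, B t; P] =
    v / 2 * (|s| ^ (2 * H) + |t| ^ (2 * H) - |s - t| ^ (2 * H))
  continuous_paths : ∀ᵐ ω ∂P, Continuous fun t => B t ω

/-- The nondecimated wavelet atom `2 ^ (j / 2) * ψ (2 ^ j * (x - k))` at level `j` and
location `k`. -/
def ndwtAtom (ψ : ℝ → ℝ) (j : ℤ) (k : ℝ) (x : ℝ) : ℝ :=
  (2 : ℝ) ^ ((j : ℝ) / 2) * ψ ((2 : ℝ) ^ j * (x - k))

/-- The nondecimated wavelet coefficient `d_{jk}` of the random path `B`. -/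
def ndwtCoeff {Ω : Type*} (ψ : ℝ → ℝ) (j : ℤ) (k : ℝ) (B : ℝ → Ω → ℝ) (ω : Ω) : ℝ :=
  ∫ t, B t ω * ndwtAtom ψ j k t

/-- The sample median of `x 0, …, x (N - 1)`: the middle order statistic if `N` is odd, the
average of the two middle order statistics if `N` is even (`Tuple.sort x` is the permutation that
puts `x` in nondecreasing order). -/
def sampleMedian {N : ℕ} [NeZero N] (x : Fin N → ℝ) : ℝ :=
  (x (Tuple.sort x ⟨(N - 1) / 2, by have := NeZero.pos N; omega⟩) +
    x (Tuple.sort x ⟨N / 2, by have := NeZero.pos N; omega⟩)) / 2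

/-- The standard normal quantile function `Φ⁻¹`. -/
def stdNormalQuantile (p : ℝ) : ℝ := sInf {x : ℝ | p ≤ cdf (gaussianReal 0 1) x}

/-- `Q = (Φ⁻¹ (3 / 4)) ^ 2`. -/
def medlQ : ℝ := stdNormalQuantile (3 / 4) ^ 2

end

/-! Each coefficient is a centred normal variable whose variance is a positive factor depending on
`j` and `H` only, times `σ ^ 2`. So `log (d_i ^ 2)` is `log (Z_i ^ 2)` with `Z_i` standard normal,
plus one constant common to the sample. The constant shifts the median and leaves its variance
alone, so that variance is the one for `N` independent copies of `log (Z ^ 2)`; this is `V N`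
(`memLp_and_variance_sampleMedian_log_sq`).

Normality (`map_integral_mul`): with time discretized by a simple function, the path integral is a
finite linear combination of jointly Gaussian variables. The discretizations converge in mean
because the mean of `|B s - B t|` is at most `√v * |s - t| ^ H`, hence characteristic functions
converge. The variance (`fbmIntegralVar_ndwtAtom`) comes from self-similarity and stationary
increments: translating the covariance kernel adds functions of one variable, which a `ψ` of
integral zero annihilates.

Asymptotics (`tendsto_mul_medianVariance`): for a law with continuous distribution function `F`,
median `m`, `f = F' m > 0` and finite fourth moment, `N * Var → 1 / (4 * f ^ 2)`. Here `F` of an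
order statistic has explicit Beta moments, and in the middle of the sample `N` times its variance
tends to `1 / 4`. Write `x - m = f⁻¹ * (F x - 1 / 2) + r x`. Near `m`, `r` is small relative to `F -
1 / 2`; away from `m`, a binomial tail bound makes the probability exponentially small and the
fourth moment controls `r`. For even `N` the gap between the two middle order statistics is
negligible as well, and Cauchy–Schwarz removes the cross term.

For `log (Z ^ 2)`, `F x = 2 * Φ (exp (x / 2)) - 1`, so `m = log Q` and `f = φ q * q` with `q = Φ⁻¹
(3 / 4)` and `φ = Φ'`, which gives `π * exp Q / (2 * Q)`. -/

/-! ### The standard normal distribution function and its quantiles -/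

section GaussianCDF

/-- The standard normal density. -/
noncomputable def stdNormalPDF (x : ℝ) : ℝ := (√(2 * Real.pi))⁻¹ * Real.exp (-x ^ 2 / 2)

lemma gaussianPDFReal_zero_one : gaussianPDFReal 0 1 = stdNormalPDF := by
  ext x
  simp [gaussianPDFReal, stdNormalPDF]

lemma continuous_stdNormalPDF : Continuous stdNormalPDF := by
  unfold stdNormalPDF; fun_prop

lemma integrable_stdNormalPDF : Integrable stdNormalPDF := by
  rw [← gaussianPDFReal_zero_one]; exact integrable_gaussianPDFReal 0 1

lemma stdNormalPDF_pos (x : ℝ) : 0 < stdNormalPDF x := by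
  unfold stdNormalPDF; positivity

lemma cdf_gaussianReal_eq_integral (x : ℝ) :
    cdf (gaussianReal 0 1) x = ∫ t in Set.Iic x, stdNormalPDF t := by
  rw [cdf_eq_real, measureReal_def, gaussianReal_apply_eq_integral 0 one_ne_zero,
    gaussianPDFReal_zero_one, ENNReal.toReal_ofReal]
  exact integral_nonneg fun t => (stdNormalPDF_pos t).le

lemma cdf_gaussianReal_neg (x : ℝ) :
    cdf (gaussianReal 0 1) (-x) = 1 - cdf (gaussianReal 0 1) x := by
  have h : (gaussianReal 0 1).map (fun x => -x) = gaussianReal 0 1 := by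
    rw [gaussianReal_map_neg, neg_zero]
  have := nullSingletonClass_gaussianReal (μ := 0) (v := 1) one_ne_zero
  rw [cdf_eq_real, cdf_eq_real]
  conv_lhs => rw [← h]
  rw [map_measureReal_apply measurable_neg measurableSet_Iic]
  have : (fun x : ℝ => -x) ⁻¹' Set.Iic (-x) = Set.Ici x := by ext; simp
  rw [this, ← Set.compl_Iio, probReal_compl_eq_one_sub measurableSet_Iio,
    measureReal_congr Iio_ae_eq_Iic]

lemma cdf_gaussianReal_zero : cdf (gaussianReal 0 1) 0 = 1 / 2 := by
  have := cdf_gaussianReal_neg 0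
  rw [neg_zero] at this
  linarith

lemma cdf_gaussianReal_eq (x : ℝ) :
    cdf (gaussianReal 0 1) x = 1 / 2 + ∫ t in (0 : ℝ)..x, stdNormalPDF t := by
  rw [← cdf_gaussianReal_zero, cdf_gaussianReal_eq_integral, cdf_gaussianReal_eq_integral,
    ← intervalIntegral.integral_Iic_sub_Iic integrable_stdNormalPDF.integrableOn
      integrable_stdNormalPDF.integrableOn]
  ring

lemma hasDerivAt_cdf_gaussianReal (x : ℝ) :
    HasDerivAt (cdf (gaussianReal 0 1)) (stdNormalPDF x) x := by
  have h := intervalIntegral.integral_hasDerivAt_right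
    (continuous_stdNormalPDF.intervalIntegrable 0 x)
    continuous_stdNormalPDF.aestronglyMeasurable.stronglyMeasurableAtFilter
    continuous_stdNormalPDF.continuousAt
  rw [show (cdf (gaussianReal 0 1) : ℝ → ℝ) = fun x => 1 / 2 + ∫ t in (0 : ℝ)..x, stdNormalPDF t
    from funext cdf_gaussianReal_eq]
  exact h.const_add _

lemma continuous_cdf_gaussianReal : Continuous (cdf (gaussianReal 0 1)) :=
  continuous_iff_continuousAt.2 fun x => (hasDerivAt_cdf_gaussianReal x).continuousAt

lemma strictMono_cdf_gaussianReal : StrictMono (cdf (gaussianReal 0 1)) :=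
  strictMono_of_deriv_pos fun x => by
    rw [(hasDerivAt_cdf_gaussianReal x).deriv]; exact stdNormalPDF_pos x

lemma cdf_stdNormalQuantile {p : ℝ} (h0 : 0 < p) (h1 : p < 1) :
    cdf (gaussianReal 0 1) (stdNormalQuantile p) = p := by
  obtain ⟨a, ha⟩ := ((tendsto_cdf_atBot (gaussianReal 0 1)).eventually_lt_const h0).exists
  obtain ⟨b, hb⟩ := ((tendsto_cdf_atTop (gaussianReal 0 1)).eventually_const_lt h1).exists
  obtain ⟨x, hx⟩ := mem_range_of_exists_le_of_exists_ge continuous_cdf_gaussianReal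
    ⟨a, ha.le⟩ ⟨b, hb.le⟩
  have : {y : ℝ | p ≤ cdf (gaussianReal 0 1) y} = Set.Ici x := by
    ext y
    simp only [Set.mem_ofPred_eq, Set.mem_Ici]
    rw [← hx, strictMono_cdf_gaussianReal.le_iff_le]
  rw [stdNormalQuantile, this, csInf_Ici, hx]

end GaussianCDF

/-! ### Numerical value of the constant -/

section Numerics

lemma abs_exp_neg_half_sq_sub_le {t : ℝ} (h0 : 0 ≤ t) (h1 : t ≤ 1) :
    |Real.exp (-t ^ 2 / 2) - (1 - t ^ 2 / 2 + t ^ 4 / 8 - t ^ 6 / 48 + t ^ 8 / 384 - t ^ 10 / 3840)|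
      ≤ t ^ 12 / 30000 := by
  have ht : |-t ^ 2 / 2| = t ^ 2 / 2 := by
    rw [neg_div, abs_neg, abs_of_nonneg (by positivity)]
  have h := Real.exp_bound (x := -t ^ 2 / 2) (n := 6) (by rw [ht]; nlinarith) (by norm_num)
  rw [ht] at h
  simp only [Finset.sum_range_succ, Finset.sum_range_zero, Nat.factorial] at h
  norm_num at h
  -- The factor `7 / 4320 = 7 / (6! * 6)` is the error of the six-term exponential sum, and `7 /
  -- (4320 * 64) < 1 / 30000`.
  have e : (t ^ 2 / 2) ^ 6 * (7 / 4320) ≤ t ^ 12 / 30000 := by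
    have : 0 ≤ t ^ 12 := by positivity
    nlinarith
  refine le_trans (le_of_eq ?_) (h.trans e)
  congr 1
  ring

lemma abs_integral_exp_neg_half_sq_sub_le {x : ℝ} (h0 : 0 ≤ x) (h1 : x ≤ 1) :
    |(∫ t in (0 : ℝ)..x, Real.exp (-t ^ 2 / 2)) - (x - x ^ 3 / 6 + x ^ 5 / 40 - x ^ 7 / 336
      + x ^ 9 / 3456 - x ^ 11 / 42240)| ≤ x ^ 13 / 390000 := by
  have hp : (∫ t in (0 : ℝ)..x, (1 - t ^ 2 / 2 + t ^ 4 / 8 - t ^ 6 / 48 + t ^ 8 / 384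
      - t ^ 10 / 3840)) = x - x ^ 3 / 6 + x ^ 5 / 40 - x ^ 7 / 336
      + x ^ 9 / 3456 - x ^ 11 / 42240 := by
    have hd : ∀ t ∈ Set.uIcc 0 x, HasDerivAt (fun x : ℝ => x - x ^ 3 / 6 + x ^ 5 / 40 - x ^ 7 / 336
      + x ^ 9 / 3456 - x ^ 11 / 42240) (1 - t ^ 2 / 2 + t ^ 4 / 8 - t ^ 6 / 48 + t ^ 8 / 384
      - t ^ 10 / 3840) t := by
      intro t _
      have := ((((((hasDerivAt_id' t).sub ((hasDerivAt_pow 3 t).div_const 6)).add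
        ((hasDerivAt_pow 5 t).div_const 40)).sub ((hasDerivAt_pow 7 t).div_const 336)).add
        ((hasDerivAt_pow 9 t).div_const 3456)).sub ((hasDerivAt_pow 11 t).div_const 42240))
      refine HasDerivAt.congr_deriv this ?_
      norm_num
      ring
    rw [intervalIntegral.integral_eq_sub_of_hasDerivAt hd
      (Continuous.intervalIntegrable (by fun_prop) _ _)]
    norm_num
  have hb : (∫ t in (0 : ℝ)..x, t ^ 12 / 30000) = x ^ 13 / 390000 := by
    rw [intervalIntegral.integral_div, integral_pow]; norm_num; ring
  rw [← hp, ← hb, ← intervalIntegral.integral_sub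
    (Continuous.intervalIntegrable (by fun_prop) _ _)
    (Continuous.intervalIntegrable (by fun_prop) _ _)]
  refine (intervalIntegral.abs_integral_le_integral_abs h0).trans
    (intervalIntegral.integral_mono_on h0
    (Continuous.intervalIntegrable (by fun_prop) _ _)
    (Continuous.intervalIntegrable (by fun_prop) _ _) fun t ht => ?_)
  exact abs_exp_neg_half_sq_sub_le ht.1 (ht.2.trans h1)

lemma integral_stdNormalPDF (x : ℝ) : ∫ t in (0 : ℝ)..x, stdNormalPDF t =
    (√(2 * Real.pi))⁻¹ * ∫ t in (0 : ℝ)..x, Real.exp (-t ^ 2 / 2) := by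
  simp only [stdNormalPDF, intervalIntegral.integral_const_mul]

lemma sqrt_two_pi_bounds : 2.50662827 < √(2 * Real.pi) ∧ √(2 * Real.pi) < 2.50662828 := by
  have h1 := Real.pi_gt_d20
  have h2 := Real.pi_lt_d20
  constructor
  · apply Real.lt_sqrt_of_sq_lt; norm_num at *; linarith
  · rw [Real.sqrt_lt' (by norm_num)]; norm_num at *; linarith

/-- By monotonicity of `Φ` it suffices to compare `Φ` with `3 / 4` at both end points, that is, the
integral of `exp (-t ^ 2 / 2)` with `√(2 * π) / 4`. -/
lemma stdNormalQuantile_bounds :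
    0.674489 < stdNormalQuantile (3 / 4) ∧ stdNormalQuantile (3 / 4) < 0.674491 := by
  obtain ⟨s1, s2⟩ := sqrt_two_pi_bounds
  have hs : 0 < √(2 * Real.pi) := by positivity
  have hq := cdf_stdNormalQuantile (p := 3 / 4) (by norm_num) (by norm_num)
  constructor
  · rw [← strictMono_cdf_gaussianReal.lt_iff_lt, hq, cdf_gaussianReal_eq, integral_stdNormalPDF]
    have h := (abs_le.1 (abs_integral_exp_neg_half_sq_sub_le (x := 0.674489)
      (by norm_num) (by norm_num))).2
    have : (√(2 * Real.pi))⁻¹ * (∫ t in (0 : ℝ)..0.674489, Real.exp (-t ^ 2 / 2)) < 1 / 4 := by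
      rw [inv_mul_lt_iff₀ hs]
      norm_num at *
      linarith
    linarith
  · rw [← strictMono_cdf_gaussianReal.lt_iff_lt, hq, cdf_gaussianReal_eq, integral_stdNormalPDF]
    have h := (abs_le.1 (abs_integral_exp_neg_half_sq_sub_le (x := 0.674491)
      (by norm_num) (by norm_num))).1
    have : 1 / 4 < (√(2 * Real.pi))⁻¹ * (∫ t in (0 : ℝ)..0.674491, Real.exp (-t ^ 2 / 2)) := by
      rw [lt_inv_mul_iff₀ hs]
      norm_num at *
      linarith
    linarith

/-- Since `exp (x - y) ≥ 1 - (y - x)`, it is enough that `y * (1 - (y - x)) - x = (y - x) * (1 - y)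
≥ 0`. An upper bound of `exp Q / Q` then needs the exponential only at the lower bound of `Q`. -/
lemma exp_div_le_exp_div {x y : ℝ} (hx : 0 < x) (hxy : x ≤ y) (hy : y ≤ 1) :
    Real.exp y / y ≤ Real.exp x / x := by
  rw [div_le_div_iff₀ (hx.trans_le hxy) hx]
  have h := Real.add_one_le_exp (-(y - x))
  have e : Real.exp y * Real.exp (-(y - x)) = Real.exp x := by rw [← Real.exp_add]; ring_nf
  have h2 : Real.exp y * (1 - (y - x)) ≤ Real.exp x := by
    rw [← e]; gcongr; linarith
  have h3 : Real.exp y * x ≤ Real.exp y * (1 - (y - x)) * y := by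
    rw [mul_assoc]
    gcongr
    nlinarith
  exact h3.trans (by have := hx.trans_le hxy; gcongr)

lemma abs_medl_constant_sub_lt :
    |Real.pi * Real.exp medlQ / (2 * medlQ) - 5.4418| < 0.00005 := by
  obtain ⟨q1, q2⟩ := stdNormalQuantile_bounds
  have p1 := Real.pi_gt_d20
  have p2 := Real.pi_lt_d20
  -- This is exactly `0.674489 ^ 2`; the upper bound is `0.674491 ^ 2` rounded up.
  have Q1 : (0.454935411121 : ℝ) ≤ medlQ := by
    unfold medlQ; nlinarith
  have Q2 : medlQ ≤ 0.454938110 := by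
    unfold medlQ; nlinarith
  have hb := Real.exp_bound (x := 0.454935411121) (n := 9) (by norm_num [abs_le]) (by norm_num)
  simp only [Finset.sum_range_succ, Finset.sum_range_zero, Nat.factorial] at hb
  norm_num at hb
  obtain ⟨b1, b2⟩ := abs_le.1 hb
  have u := exp_div_le_exp_div (by norm_num) Q1 (by linarith)
  have hQ : 0 < medlQ := by linarith
  have el := Real.exp_le_exp.2 Q1
  have e : Real.pi * Real.exp medlQ / (2 * medlQ) = Real.pi / 2 * (Real.exp medlQ / medlQ) := by
    field_simp
  have lo : 3.464340 ≤ Real.exp medlQ / medlQ := by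
    rw [le_div_iff₀ hQ]
    refine le_trans ?_ el
    norm_num at *
    linarith
  have hi : Real.exp medlQ / medlQ ≤ 3.4643858 := by
    refine u.trans ?_
    rw [div_le_iff₀ (by norm_num)]
    norm_num at *
    linarith
  rw [e, abs_lt]
  norm_num at *
  constructor <;> nlinarith

end Numerics

/-! ### Order statistics and binomial probabilities -/

section OrderStatistics

/-- The `j`-th order statistic of the tuple `x`. -/
noncomputable def orderStat {N : ℕ} (x : Fin N → ℝ) (j : Fin N) : ℝ := x (Tuple.sort x j)

/-- Sorting is a permutation and so preserves counts. This turns events about order statistics into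
events about a binomial count; positions start at `0`, hence the strict inequality. -/
lemma orderStat_le_iff {N : ℕ} (x : Fin N → ℝ) (j : Fin N) (t : ℝ) :
    orderStat x j ≤ t ↔ (j : ℕ) < (Finset.univ.filter fun i => x i ≤ t).card := by
  have h := Tuple.lt_card_le_iff_apply_le_of_monotone (j := j) (a := t) (Tuple.monotone_sort x)
  have hc : (Finset.univ.filter fun i => (x ∘ Tuple.sort x) i ≤ t).card =
      (Finset.univ.filter fun i => x i ≤ t).card :=
    Finset.card_equiv (Tuple.sort x) (by simp)
  rw [hc] at h
  exact h.symm

lemma orderStat_mono {N : ℕ} (x : Fin N → ℝ) : Monotone (orderStat x) :=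
  Tuple.monotone_sort x

lemma orderStat_eq_of_forall_le_iff {N : ℕ} {x : Fin N → ℝ} {j : Fin N} {a : ℝ}
    (h : ∀ t, a ≤ t ↔ (j : ℕ) < (Finset.univ.filter fun i => x i ≤ t).card) :
    orderStat x j = a :=
  eq_of_forall_ge_iff fun t => by rw [orderStat_le_iff, h]

lemma orderStat_add_const {N : ℕ} (x : Fin N → ℝ) (j : Fin N) (c : ℝ) :
    orderStat (fun i => x i + c) j = orderStat x j + c := by
  refine orderStat_eq_of_forall_le_iff fun t => ?_
  rw [← le_sub_iff_add_le, orderStat_le_iff]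
  simp only [le_sub_iff_add_le]

lemma sampleMedian_eq {N : ℕ} [NeZero N] (x : Fin N → ℝ) :
    sampleMedian x = (orderStat x ⟨(N - 1) / 2, by have := NeZero.pos N; omega⟩ +
      orderStat x ⟨N / 2, by have := NeZero.pos N; omega⟩) / 2 := rfl

lemma sampleMedian_add_const {N : ℕ} [NeZero N] (x : Fin N → ℝ) (c : ℝ) :
    sampleMedian (fun i => x i + c) = sampleMedian x + c := by
  rw [sampleMedian_eq, sampleMedian_eq, orderStat_add_const, orderStat_add_const]
  ring

variable {N : ℕ}

lemma measurableSet_filter_eq {S : Set ℝ} [DecidablePred (· ∈ S)] (hS : MeasurableSet S)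
    (T : Finset (Fin N)) :
    MeasurableSet {x : Fin N → ℝ | (Finset.univ.filter fun i => x i ∈ S) = T} := by
  simp only [Finset.ext_iff, Finset.mem_filter, Finset.mem_univ, true_and]
  rw [Set.ofPred_forall]
  have : ∀ i, Measurable fun x : Fin N → ℝ => x i := measurable_pi_apply
  refine MeasurableSet.iInter fun i => ?_
  by_cases h : i ∈ T
  · simp only [h, iff_true]
    exact hS.preimage (this i)
  · simp only [h, iff_false]
    exact (hS.preimage (this i)).compl

lemma measurableSet_card_filter {S : Set ℝ} [DecidablePred (· ∈ S)] (hS : MeasurableSet S)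
    (A : Set ℕ) :
    MeasurableSet {x : Fin N → ℝ | (Finset.univ.filter fun i => x i ∈ S).card ∈ A} := by
  have : {x : Fin N → ℝ | (Finset.univ.filter fun i => x i ∈ S).card ∈ A} =
      ⋃ T ∈ {T : Finset (Fin N) | T.card ∈ A},
        {x : Fin N → ℝ | (Finset.univ.filter fun i => x i ∈ S) = T} := by
    ext x; simp
  rw [this]
  exact MeasurableSet.biUnion (Set.to_countable _) fun T _ => measurableSet_filter_eq hS T

lemma measurable_orderStat (j : Fin N) : Measurable fun x : Fin N → ℝ => orderStat x j := by
  refine measurable_of_Iic fun t => ?_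
  have : (fun x : Fin N → ℝ => orderStat x j) ⁻¹' Set.Iic t =
      {x | (Finset.univ.filter fun i => x i ∈ Set.Iic t).card ∈ Set.Ioi (j : ℕ)} := by
    ext x
    simp [orderStat_le_iff]
  rw [this]
  exact measurableSet_card_filter measurableSet_Iic _

variable (μ : Measure ℝ) [IsProbabilityMeasure μ]

/-- The event is a box with sides `S` and `Sᶜ`, so its probability is a product. -/
lemma pi_real_filter_eq {S : Set ℝ} [DecidablePred (· ∈ S)] (hS : MeasurableSet S)
    (T : Finset (Fin N)) :
    (Measure.pi fun _ : Fin N => μ).real {x | (Finset.univ.filter fun i => x i ∈ S) = T} =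
      μ.real S ^ T.card * (1 - μ.real S) ^ (N - T.card) := by
  have : {x : Fin N → ℝ | (Finset.univ.filter fun i => x i ∈ S) = T} =
      Set.pi Set.univ fun i => if i ∈ T then S else Sᶜ := by
    ext x
    simp only [Finset.ext_iff, Finset.mem_filter, Finset.mem_univ, true_and, Set.mem_ofPred_eq,
      Set.mem_pi, Set.mem_univ, true_imp_iff]
    refine forall_congr' fun i => ?_
    by_cases h : i ∈ T <;> simp [h]
  rw [this, measureReal_def, Measure.pi_pi, ENNReal.toReal_prod]
  have h2 : ∀ i : Fin N, (μ (if i ∈ T then S else Sᶜ)).toReal =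
      if i ∈ T then μ.real S else 1 - μ.real S := by
    intro i
    split_ifs
    · rfl
    · exact probReal_compl_eq_one_sub hS
  simp only [h2]
  rw [Finset.prod_ite, Finset.prod_const, Finset.prod_const]
  congr 2
  · simp
  · rw [Finset.filter_not, Finset.card_sdiff_of_subset (by simp)]
    simp

lemma pi_real_card_filter_eq {S : Set ℝ} [DecidablePred (· ∈ S)] (hS : MeasurableSet S) (n : ℕ) :
    (Measure.pi fun _ : Fin N => μ).real {x | (Finset.univ.filter fun i => x i ∈ S).card = n} =
      N.choose n * μ.real S ^ n * (1 - μ.real S) ^ (N - n) := by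
  have : {x : Fin N → ℝ | (Finset.univ.filter fun i => x i ∈ S).card = n} =
      ⋃ T ∈ Finset.powersetCard n (Finset.univ : Finset (Fin N)),
        {x : Fin N → ℝ | (Finset.univ.filter fun i => x i ∈ S) = T} := by
    ext x; simp
  rw [this, measureReal_biUnion_finset]
  · rw [Finset.sum_congr rfl (g := fun _ => μ.real S ^ n * (1 - μ.real S) ^ (N - n))]
    · simp [mul_assoc]
    · intro T hT
      rw [pi_real_filter_eq μ hS, (Finset.mem_powersetCard.1 hT).2]
  · intro T _ T' _ h
    refine Set.disjoint_left.2 fun x hx hx' => h ?_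
    exact hx.symm.trans hx'
  · exact fun T _ => measurableSet_filter_eq hS T

lemma pi_real_card_filter_mem {S : Set ℝ} [DecidablePred (· ∈ S)] (hS : MeasurableSet S)
    (A : Finset ℕ) :
    (Measure.pi fun _ : Fin N => μ).real {x | (Finset.univ.filter fun i => x i ∈ S).card ∈ A} =
      ∑ n ∈ A, N.choose n * μ.real S ^ n * (1 - μ.real S) ^ (N - n) := by
  have : {x : Fin N → ℝ | (Finset.univ.filter fun i => x i ∈ S).card ∈ A} =
      ⋃ n ∈ A, {x : Fin N → ℝ | (Finset.univ.filter fun i => x i ∈ S).card = n} := by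
    ext x; simp
  rw [this, measureReal_biUnion_finset]
  · exact Finset.sum_congr rfl fun n _ => pi_real_card_filter_eq μ hS n
  · intro T _ T' _ h
    refine Set.disjoint_left.2 fun x hx hx' => h ?_
    exact hx.symm.trans hx'
  · exact fun n _ => by simpa using measurableSet_card_filter hS {n}

lemma pi_real_lt_orderStat (j : Fin N) (t : ℝ) :
    (Measure.pi fun _ : Fin N => μ).real {x | t < orderStat x j} =
      ∑ n ∈ Finset.range (j + 1), N.choose n * μ.real (Set.Iic t) ^ n *
        (1 - μ.real (Set.Iic t)) ^ (N - n) := by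
  rw [← pi_real_card_filter_mem μ measurableSet_Iic]
  congr 1
  ext x
  simp only [Set.mem_ofPred_eq, Finset.mem_range, Nat.lt_succ_iff, Set.mem_Iic]
  rw [← not_le, orderStat_le_iff, not_lt]

lemma pi_real_orderStat_le (j : Fin N) (t : ℝ) :
    (Measure.pi fun _ : Fin N => μ).real {x | orderStat x j ≤ t} =
      ∑ n ∈ Finset.Ioc (j : ℕ) N, N.choose n * μ.real (Set.Iic t) ^ n *
        (1 - μ.real (Set.Iic t)) ^ (N - n) := by
  rw [← pi_real_card_filter_mem μ measurableSet_Iic]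
  congr 1
  ext x
  have : (Finset.univ.filter fun i => x i ≤ t).card ≤ N := by
    simpa using Finset.card_filter_le (Finset.univ : Finset (Fin N)) (fun i => x i ≤ t)
  simp [orderStat_le_iff, this]

end OrderStatistics

/-! ### Exponential bounds for binomial tails -/

section BinomialTail

/-- The excess exponent `N - 2 * i` falls on the smaller number `q`, and `q ≤ √(p * q)`. -/
lemma pow_mul_pow_le_sqrt_pow {p q : ℝ} (hq : 0 ≤ q) (hqp : q ≤ p) {i N : ℕ} (hi : 2 * i ≤ N) :
    p ^ i * q ^ (N - i) ≤ √(p * q) ^ N := by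
  have hp : 0 ≤ p := hq.trans hqp
  refine le_of_sq_le_sq ?_ (by positivity)
  rw [← pow_mul, mul_comm N 2, pow_mul √(p * q) 2 N, Real.sq_sqrt (by positivity)]
  obtain ⟨k, rfl⟩ := Nat.exists_eq_add_of_le hi
  have e : 2 * i + k - i = i + k := by omega
  calc (p ^ i * q ^ (2 * i + k - i)) ^ 2 = (p * q) ^ (2 * i) * (q * q) ^ k := by rw [e]; ring
    _ ≤ (p * q) ^ (2 * i) * (p * q) ^ k := by gcongr
    _ = (p * q) ^ (2 * i + k) := by ring

/-- Every summand has the same bound up to its binomial coefficient, and the coefficients sum to `2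
^ N`. -/
lemma sum_choose_mul_pow_le {p q : ℝ} {N : ℕ} {A : Finset ℕ}
    (hA : ∀ i ∈ A, i ≤ N ∧ p ^ i * q ^ (N - i) ≤ √(p * q) ^ N) :
    ∑ i ∈ A, (N.choose i : ℝ) * p ^ i * q ^ (N - i) ≤ (2 * √(p * q)) ^ N := by
  calc ∑ i ∈ A, (N.choose i : ℝ) * p ^ i * q ^ (N - i)
      ≤ ∑ i ∈ A, (N.choose i : ℝ) * √(p * q) ^ N := by
        refine Finset.sum_le_sum fun i hi => ?_
        rw [mul_assoc]
        gcongr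
        exact (hA i hi).2
    _ ≤ ∑ i ∈ Finset.range (N + 1), (N.choose i : ℝ) * √(p * q) ^ N := by
        refine Finset.sum_le_sum_of_subset_of_nonneg (fun i hi => ?_) fun _ _ _ => by positivity
        have := (hA i hi).1
        simp; omega
    _ = (2 * √(p * q)) ^ N := by
        rw [← Finset.sum_mul, mul_pow]
        congr 1
        exact_mod_cast Nat.sum_range_choose N

variable (μ : Measure ℝ) [IsProbabilityMeasure μ] {N : ℕ}

lemma pi_real_lt_orderStat_le (j : Fin N) (hj : 2 * (j : ℕ) ≤ N) {t : ℝ}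
    (ht : 1 / 2 ≤ μ.real (Set.Iic t)) :
    (Measure.pi fun _ : Fin N => μ).real {x | t < orderStat x j} ≤
      (2 * √(μ.real (Set.Iic t) * (1 - μ.real (Set.Iic t)))) ^ N := by
  have h1 : μ.real (Set.Iic t) ≤ 1 := measureReal_le_one
  rw [pi_real_lt_orderStat]
  refine sum_choose_mul_pow_le fun i hi => ?_
  have hi' : i < j + 1 := Finset.mem_range.1 hi
  exact ⟨by omega, pow_mul_pow_le_sqrt_pow (by linarith) (by linarith) (by omega)⟩

lemma pi_real_orderStat_le_le (j : Fin N) (hj : N ≤ 2 * (j : ℕ) + 2) {t : ℝ}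
    (ht : μ.real (Set.Iic t) ≤ 1 / 2) :
    (Measure.pi fun _ : Fin N => μ).real {x | orderStat x j ≤ t} ≤
      (2 * √(μ.real (Set.Iic t) * (1 - μ.real (Set.Iic t)))) ^ N := by
  have h0 : 0 ≤ μ.real (Set.Iic t) := measureReal_nonneg
  rw [pi_real_orderStat_le]
  refine sum_choose_mul_pow_le fun i hi => ?_
  have hi' := Finset.mem_Ioc.1 hi
  refine ⟨hi'.2, ?_⟩
  -- Successes and failures are exchanged: `i ≥ j + 1` and `N ≤ 2 * j + 2` give `2 * (N - i) ≤ N`.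
  have := pow_mul_pow_le_sqrt_pow (p := 1 - μ.real (Set.Iic t)) (q := μ.real (Set.Iic t)) h0
    (by linarith) (i := N - i) (N := N) (by omega)
  rw [Nat.sub_sub_self hi'.2] at this
  rwa [mul_comm, mul_comm (μ.real _)]

lemma two_mul_sqrt_lt_one {p : ℝ} (hp : p ≠ 1 / 2) : 2 * √(p * (1 - p)) < 1 := by
  have : √(p * (1 - p)) < 1 / 2 := by
    rw [Real.sqrt_lt' (by norm_num)]
    have : 0 < (p - 1 / 2) ^ 2 := by
      have := sub_ne_zero.2 hp
      positivity
    nlinarith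
  linarith

end BinomialTail

/-! ### Beta moments of transformed order statistics -/

section Moments

/-- Consecutive Bernstein polynomials of degree `n` differ by the derivative of one of degree `n +
1` divided by `n + 1`. Its boundary values vanish unless `k = n`, so all the integrals agree with
the last one; the induction descends from the zero polynomial at `k = n + 1`. -/
lemma integral_bernsteinPolynomial {n k : ℕ} (hk : k ≤ n) :
    ∫ u in (0 : ℝ)..1, (n.choose k : ℝ) * u ^ k * (1 - u) ^ (n - k) = 1 / (n + 1) := by
  have key : ∀ k, (∫ u in (0 : ℝ)..1, (bernsteinPolynomial ℝ n k).eval u) -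
      ∫ u in (0 : ℝ)..1, (bernsteinPolynomial ℝ n (k + 1)).eval u =
      if k = n then 1 / ((n : ℝ) + 1) else 0 := by
    intro k
    rw [← intervalIntegral.integral_sub ((Polynomial.continuous _).intervalIntegrable _ _)
      ((Polynomial.continuous _).intervalIntegrable _ _)]
    have hd : ∀ u : ℝ, HasDerivAt
        (fun u => (bernsteinPolynomial ℝ (n + 1) (k + 1)).eval u / ((n : ℝ) + 1))
        ((bernsteinPolynomial ℝ n k).eval u - (bernsteinPolynomial ℝ n (k + 1)).eval u) u := by
      intro u
      have h := ((bernsteinPolynomial ℝ (n + 1) (k + 1)).hasDerivAt u).div_const ((n : ℝ) + 1)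
      rw [bernsteinPolynomial.derivative_succ] at h
      refine h.congr_deriv ?_
      simp
      field_simp
    rw [intervalIntegral.integral_eq_sub_of_hasDerivAt (fun u _ => hd u)
      (Continuous.intervalIntegrable (by fun_prop) _ _),
      bernsteinPolynomial.eval_at_0, bernsteinPolynomial.eval_at_1]
    by_cases h : k = n <;> simp [h]
  have main : ∀ d k, k + d = n →
      ∫ u in (0 : ℝ)..1, (bernsteinPolynomial ℝ n k).eval u = 1 / ((n : ℝ) + 1) := by
    intro d
    induction d with
    | zero =>
      intro k hk
      have h := key k
      rw [bernsteinPolynomial.eq_zero_of_lt ℝ (show n < k + 1 by omega)] at h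
      simpa [show k = n by omega] using h
    | succ d ih =>
      intro k hk
      have h := key k
      rw [ih (k + 1) (by omega), if_neg (by omega)] at h
      linarith
  rw [← main (n - k) k (by omega)]
  simp [bernsteinPolynomial]

/-- Multiplying by `u` gives a multiple of the Bernstein polynomial of degree `n + 1` and index `k +
1`. -/
lemma integral_mul_bernsteinPolynomial {n k : ℕ} (hk : k ≤ n) :
    ∫ u in (0 : ℝ)..1, 2 * u * ((n.choose k : ℝ) * u ^ k * (1 - u) ^ (n - k)) =
      2 * (k + 1) / ((n + 1) * (n + 2)) := by
  have h := integral_bernsteinPolynomial (show k + 1 ≤ n + 1 by omega)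
  have hc : ((n + 1 : ℕ) : ℝ) * n.choose k = (n + 1).choose (k + 1) * (k + 1 : ℕ) := by
    exact_mod_cast Nat.add_one_mul_choose_eq n k
  push_cast at hc
  rw [Nat.cast_add, Nat.cast_one] at h
  have e : ∀ u : ℝ, 2 * u * ((n.choose k : ℝ) * u ^ k * (1 - u) ^ (n - k)) =
      2 * (k + 1) / (n + 1) *
        (((n + 1).choose (k + 1) : ℝ) * u ^ (k + 1) * (1 - u) ^ (n + 1 - (k + 1))) := by
    intro u
    rw [Nat.add_sub_add_right]
    field_simp
    linear_combination (u ^ k * u * (1 - u) ^ (n - k)) * hc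
  simp_rw [e]
  rw [intervalIntegral.integral_const_mul, h]
  field_simp
  ring

/-- Layer cake formula for a random variable with values in the unit interval. -/
lemma integral_comp_eq_integral_mul_measureReal_lt {Ω : Type*} [MeasurableSpace Ω] (P : Measure Ω)
    [IsProbabilityMeasure P] {U : Ω → ℝ} (hU : Measurable U) (h0 : ∀ ω, 0 ≤ U ω)
    (h1 : ∀ ω, U ω ≤ 1) {G g : ℝ → ℝ} (hg : Continuous g) (hG : ∀ u, HasDerivAt G (g u) u)
    (hG0 : G 0 = 0) :
    ∫ ω, G (U ω) ∂P = ∫ u in (0 : ℝ)..1, g u * P.real {ω | u < U ω} := by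
  have e1 : ∀ ω, G (U ω) = ∫ u in Set.Ioc (0 : ℝ) 1, {p : Ω × ℝ | p.2 < U p.1}.indicator
      (fun p => g p.2) (ω, u) := by
    intro ω
    have : (fun u => {p : Ω × ℝ | p.2 < U p.1}.indicator (fun p => g p.2) (ω, u)) =
        (Set.Iio (U ω)).indicator g := by
      ext u; simp [Set.indicator]
    rw [this, setIntegral_indicator measurableSet_Iio]
    have hI : Set.Ioc (0 : ℝ) 1 ∩ Set.Iio (U ω) = Set.Ioo 0 (U ω) := by
      ext u
      have := h1 ω
      simp only [Set.mem_inter_iff, Set.mem_Ioc, Set.mem_Iio, Set.mem_Ioo]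
      constructor
      · rintro ⟨⟨a, b⟩, c⟩; exact ⟨a, c⟩
      · rintro ⟨a, c⟩; exact ⟨⟨a, by linarith⟩, c⟩
    rw [hI, ← integral_Ioc_eq_integral_Ioo, ← intervalIntegral.integral_of_le (h0 ω),
      intervalIntegral.integral_eq_sub_of_hasDerivAt (fun u _ => hG u) (hg.intervalIntegrable _ _),
      hG0, sub_zero]
  have hS : MeasurableSet {p : Ω × ℝ | p.2 < U p.1} :=
    measurableSet_lt measurable_snd (hU.comp measurable_fst)
  have hint : Integrable ({p : Ω × ℝ | p.2 < U p.1}.indicator (fun p => g p.2))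
      (P.prod (volume.restrict (Set.Ioc (0 : ℝ) 1))) := by
    refine Integrable.indicator ?_ hS
    have : IntegrableOn g (Set.Ioc 0 1) := (hg.integrableOn_Icc).mono_set Set.Ioc_subset_Icc_self
    exact this.comp_snd P
  simp_rw [e1]
  rw [integral_integral_swap (f := fun ω u =>
    {p : Ω × ℝ | p.2 < U p.1}.indicator (fun p => g p.2) (ω, u)) hint,
    intervalIntegral.integral_of_le zero_le_one]
  refine integral_congr_ae (Eventually.of_forall fun u => ?_)
  have : (fun ω => {p : Ω × ℝ | p.2 < U p.1}.indicator (fun p => g p.2) (ω, u)) =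
      {ω | u < U ω}.indicator (fun _ => g u) := by
    ext ω; simp [Set.indicator]
  simp only [this]
  rw [integral_indicator (measurableSet_lt measurable_const hU)]
  simp [mul_comm]

/-- The distribution function may be flat at height `u`; taking the largest `t` on the level set
makes the equivalence hold without strict monotonicity. -/
lemma exists_cdf_le_iff (μ : Measure ℝ) (hF : Continuous (cdf μ)) {u : ℝ} (h0 : 0 < u)
    (h1 : u < 1) :
    ∃ t, cdf μ t = u ∧ ∀ x, cdf μ x ≤ u ↔ x ≤ t := by
  obtain ⟨a, ha⟩ := ((tendsto_cdf_atBot μ).eventually_lt_const h0).exists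
  obtain ⟨b, hb⟩ := ((tendsto_cdf_atTop μ).eventually_const_lt h1).exists
  have hne : (cdf μ ⁻¹' {u}).Nonempty :=
    mem_range_of_exists_le_of_exists_ge hF ⟨a, ha.le⟩ ⟨b, hb.le⟩
  have hbdd : BddAbove (cdf μ ⁻¹' {u}) := by
    refine ⟨b, fun x hx => ?_⟩
    by_contra! h
    have := monotone_cdf μ h.le
    rw [Set.mem_preimage, Set.mem_singleton_iff] at hx
    linarith
  have hmem : cdf μ (sSup (cdf μ ⁻¹' {u})) = u :=
    (isClosed_singleton.preimage hF).csSup_mem hne hbdd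
  refine ⟨sSup (cdf μ ⁻¹' {u}), hmem, fun x => ⟨fun hx => ?_, fun hx => hmem ▸ monotone_cdf μ hx⟩⟩
  by_contra! h
  have : cdf μ x = u := le_antisymm hx (hmem ▸ monotone_cdf μ h.le)
  exact absurd (le_csSup hbdd this) (not_le.2 h)

lemma measurable_cdf_comp_orderStat (μ : Measure ℝ) {N : ℕ} (j : Fin N) :
    Measurable fun x : Fin N → ℝ => cdf μ (orderStat x j) :=
  (monotone_cdf μ).measurable.comp (measurable_orderStat j)

variable (μ : Measure ℝ) [IsProbabilityMeasure μ] {N : ℕ}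

lemma pi_real_lt_cdf_orderStat (hF : Continuous (cdf μ)) (j : Fin N) {u : ℝ} (h0 : 0 < u)
    (h1 : u < 1) :
    (Measure.pi fun _ : Fin N => μ).real {x | u < cdf μ (orderStat x j)} =
      ∑ n ∈ Finset.range (j + 1), (N.choose n : ℝ) * u ^ n * (1 - u) ^ (N - n) := by
  obtain ⟨t, ht, hiff⟩ := exists_cdf_le_iff μ hF h0 h1
  have := pi_real_lt_orderStat μ j t
  rw [← cdf_eq_real, ht] at this
  rw [← this]
  congr 1
  ext x
  simp only [Set.mem_ofPred_eq, ← not_le, hiff]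

lemma integral_comp_cdf_orderStat (hF : Continuous (cdf μ)) (j : Fin N) {G g : ℝ → ℝ}
    (hg : Continuous g) (hG : ∀ u, HasDerivAt G (g u) u) (hG0 : G 0 = 0) :
    ∫ x, G (cdf μ (orderStat x j)) ∂(Measure.pi fun _ : Fin N => μ) =
      ∑ n ∈ Finset.range (j + 1),
        ∫ u in (0 : ℝ)..1, g u * ((N.choose n : ℝ) * u ^ n * (1 - u) ^ (N - n)) := by
  rw [integral_comp_eq_integral_mul_measureReal_lt _ (measurable_cdf_comp_orderStat μ j)
    (fun x => cdf_nonneg μ _) (fun x => cdf_le_one μ _) hg hG hG0,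
    ← intervalIntegral.integral_finsetSum
      fun n _ => Continuous.intervalIntegrable (by fun_prop) _ _]
  refine intervalIntegral.integral_congr_ae ?_
  -- The tail formula requires `u < 1`; the end point is a null set.
  have h1 : ∀ᵐ u : ℝ, u ≠ 1 := by simp [ae_iff]
  filter_upwards [h1] with u hu1 hu
  rw [Set.uIoc_of_le zero_le_one] at hu
  rw [pi_real_lt_cdf_orderStat μ hF j hu.1 (lt_of_le_of_ne hu.2 hu1), Finset.mul_sum]

lemma integral_cdf_orderStat (hF : Continuous (cdf μ)) (j : Fin N) :
    ∫ x, cdf μ (orderStat x j) ∂(Measure.pi fun _ : Fin N => μ) = (j + 1) / (N + 1) := by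
  rw [integral_comp_cdf_orderStat μ hF j (G := fun u => u) (g := fun _ => 1) continuous_const
    (fun u => hasDerivAt_id u) rfl]
  rw [Finset.sum_congr rfl (g := fun _ => (1 : ℝ) / (N + 1))]
  · simp [div_eq_mul_inv]
  · intro n hn
    have := Finset.mem_range.1 hn
    simp only [one_mul]
    exact integral_bernsteinPolynomial (by omega)

lemma integral_cdf_orderStat_sq (hF : Continuous (cdf μ)) (j : Fin N) :
    ∫ x, cdf μ (orderStat x j) ^ 2 ∂(Measure.pi fun _ : Fin N => μ) =
      (j + 1) * (j + 2) / ((N + 1) * (N + 2)) := by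
  rw [integral_comp_cdf_orderStat μ hF j (G := fun u => u ^ 2) (g := fun u => 2 * u)
    (by fun_prop) (fun u => by simpa using hasDerivAt_pow 2 u) (by simp)]
  rw [Finset.sum_congr rfl (g := fun n : ℕ => 2 * ((n : ℝ) + 1) / ((N + 1) * (N + 2)))]
  · rw [← Finset.sum_div]
    congr 1
    have : ∀ k : ℕ, ∑ n ∈ Finset.range (k + 1), 2 * ((n : ℝ) + 1) = (k + 1) * (k + 2) := by
      intro k
      induction k with
      | zero => norm_num
      | succ k ih => rw [Finset.sum_range_succ, ih]; push_cast; ring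
    exact this j
  · intro n hn
    have := Finset.mem_range.1 hn
    exact integral_mul_bernsteinPolynomial (by omega)

end Moments

/-! ### Cauchy–Schwarz for covariances -/

section CauchySchwarz

/-- The variance of `X + t • Y` is a nonnegative quadratic in `t`, so its discriminant is at most
`0`. -/
lemma covariance_sq_le {Ω : Type*} [MeasurableSpace Ω] {P : Measure Ω} [IsFiniteMeasure P]
    {X Y : Ω → ℝ} (hX : MemLp X 2 P) (hY : MemLp Y 2 P) :
    cov[X, Y; P] ^ 2 ≤ Var[X; P] * Var[Y; P] := by
  have h : ∀ t : ℝ, 0 ≤ Var[Y; P] * (t * t) + 2 * cov[X, Y; P] * t + Var[X; P] := by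
    intro t
    have h1 := variance_nonneg (X + t • Y) P
    rw [variance_add hX (hY.const_smul t), covariance_smul_right, variance_smul] at h1
    linarith
  have := discrim_le_zero h
  rw [discrim] at this
  linarith

end CauchySchwarz

/-! ### Integrability and concentration of the middle order statistics -/

section CentralOrderStatistics

variable {N : ℕ}

lemma comp_orderStat_le_sum {g : ℝ → ℝ} (hg : ∀ x, 0 ≤ g x) (x : Fin N → ℝ) (j : Fin N) :
    g (orderStat x j) ≤ ∑ i, g (x i) :=
  Finset.single_le_sum (f := fun i => g (x i)) (fun i _ => hg (x i)) (Finset.mem_univ _)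

variable (μ : Measure ℝ) [IsProbabilityMeasure μ]

lemma integrable_comp_eval {g : ℝ → ℝ} (hg : Integrable g μ) (i : Fin N) :
    Integrable (fun x : Fin N → ℝ => g (x i)) (Measure.pi fun _ : Fin N => μ) :=
  (measurePreserving_eval (fun _ : Fin N => μ) i).integrable_comp_of_integrable hg

lemma integral_comp_eval_eq {g : ℝ → ℝ} (hg : Integrable g μ) (i : Fin N) :
    ∫ x, g (x i) ∂(Measure.pi fun _ : Fin N => μ) = ∫ x, g x ∂μ := by
  have h := measurePreserving_eval (fun _ : Fin N => μ) i
  rw [← h.map_eq] at hg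
  conv_rhs => rw [← h.map_eq]
  exact (integral_map h.measurable.aemeasurable hg.aestronglyMeasurable).symm

lemma integrable_comp_orderStat {g : ℝ → ℝ} (hm : Measurable g) (h0 : ∀ x, 0 ≤ g x)
    (hg : Integrable g μ) (j : Fin N) :
    Integrable (fun x : Fin N → ℝ => g (orderStat x j)) (Measure.pi fun _ : Fin N => μ) := by
  refine (integrable_finsetSum Finset.univ fun i _ => integrable_comp_eval μ hg i).mono'
    (hm.comp (measurable_orderStat j)).aestronglyMeasurable (Eventually.of_forall fun x => ?_)
  rw [Real.norm_of_nonneg (h0 _)]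
  exact comp_orderStat_le_sum h0 x j

lemma integral_comp_orderStat_le {g : ℝ → ℝ} (hm : Measurable g) (h0 : ∀ x, 0 ≤ g x)
    (hg : Integrable g μ) (j : Fin N) :
    ∫ x, g (orderStat x j) ∂(Measure.pi fun _ : Fin N => μ) ≤ N * ∫ x, g x ∂μ := by
  calc _ ≤ ∫ x, ∑ i, g (x i) ∂(Measure.pi fun _ : Fin N => μ) :=
        integral_mono (integrable_comp_orderStat μ hm h0 hg j)
          (integrable_finsetSum Finset.univ fun i _ => integrable_comp_eval μ hg i)
          fun x => comp_orderStat_le_sum h0 x j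
    _ = N * ∫ x, g x ∂μ := by
        rw [integral_finsetSum _ fun i _ => integrable_comp_eval μ hg i]
        simp [integral_comp_eval_eq μ hg]

lemma memLp_comp_orderStat {g : ℝ → ℝ} (hm : Measurable g)
    (hg : Integrable (fun x => g x ^ 2) μ) (j : Fin N) :
    MemLp (fun x : Fin N → ℝ => g (orderStat x j)) 2 (Measure.pi fun _ : Fin N => μ) :=
  (memLp_two_iff_integrable_sq (hm.comp (measurable_orderStat j)).aestronglyMeasurable).2
    (integrable_comp_orderStat μ (hm.pow_const 2) (fun x => sq_nonneg (g x)) hg j)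

/-- The index `j` is one of the middle positions of a sample of size `N`. -/
def IsMiddle (j : Fin N) : Prop := 2 * (j : ℕ) ≤ N ∧ N ≤ 2 * (j : ℕ) + 2

lemma integrable_cdf_sq : Integrable (fun x => (cdf μ x - 1 / 2) ^ 2) μ := by
  refine Integrable.of_bound (C := 1)
    (((monotone_cdf μ).measurable.sub_const _).pow_const 2).aestronglyMeasurable
    (Eventually.of_forall fun x => ?_)
  have h0 := cdf_nonneg μ x
  have h1 := cdf_le_one μ x
  rw [Real.norm_of_nonneg (by positivity)]
  nlinarith

lemma integrable_of_measurable_of_mem_Icc {Ω : Type*} [MeasurableSpace Ω] {P : Measure Ω}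
    [IsFiniteMeasure P] {U : Ω → ℝ} (hU : Measurable U) (h0 : ∀ ω, 0 ≤ U ω) (h1 : ∀ ω, U ω ≤ 1) :
    Integrable U P :=
  Integrable.of_bound hU.aestronglyMeasurable 1 (Eventually.of_forall fun ω => by
    rw [Real.norm_of_nonneg (h0 ω)]; exact h1 ω)

lemma integrable_cdf_orderStat (j : Fin N) :
    Integrable (fun x => cdf μ (orderStat x j)) (Measure.pi fun _ : Fin N => μ) :=
  integrable_of_measurable_of_mem_Icc (measurable_cdf_comp_orderStat μ j)
    (fun _ => cdf_nonneg μ _) fun _ => cdf_le_one μ _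

lemma integrable_cdf_orderStat_sq (j : Fin N) :
    Integrable (fun x => cdf μ (orderStat x j) ^ 2) (Measure.pi fun _ : Fin N => μ) :=
  integrable_of_measurable_of_mem_Icc ((measurable_cdf_comp_orderStat μ j).pow_const 2)
    (fun _ => by positivity) fun _ => pow_le_one₀ (cdf_nonneg μ _) (cdf_le_one μ _)

lemma memLp_cdf_orderStat (j : Fin N) :
    MemLp (fun x => cdf μ (orderStat x j)) 2 (Measure.pi fun _ : Fin N => μ) :=
  (memLp_two_iff_integrable_sq (measurable_cdf_comp_orderStat μ j).aestronglyMeasurable).2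
    (integrable_cdf_orderStat_sq μ j)

/-- Expanding the square leaves the two Beta moments; with `j` between `N / 2 - 1` and `N / 2` the
result is at most `5 / (4 * (N + 1))`. -/
lemma mul_integral_cdf_orderStat_sub_half_sq_le (hF : Continuous (cdf μ)) {j : Fin N}
    (hj : IsMiddle j) :
    (N : ℝ) * ∫ x, (cdf μ (orderStat x j) - 1 / 2) ^ 2 ∂(Measure.pi fun _ : Fin N => μ) ≤ 2 := by
  have e : (∫ x, (cdf μ (orderStat x j) - 1 / 2) ^ 2 ∂(Measure.pi fun _ : Fin N => μ) : ℝ) =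
      ((j : ℕ) + 1 : ℝ) * ((j : ℕ) + 2) / ((N + 1) * (N + 2)) -
        ((j : ℕ) + 1) / (N + 1) + 1 / 4 := by
    rw [← integral_cdf_orderStat_sq μ hF, ← integral_cdf_orderStat μ hF,
      ← integral_sub (integrable_cdf_orderStat_sq μ j) (integrable_cdf_orderStat μ j)]
    have : (1 / 4 : ℝ) = ∫ _x, 1 / 4 ∂(Measure.pi fun _ : Fin N => μ) := by simp
    have i : Integrable (fun x => cdf μ (orderStat x j) ^ 2 - cdf μ (orderStat x j))
        (Measure.pi fun _ : Fin N => μ) :=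
      (integrable_cdf_orderStat_sq μ j).sub (integrable_cdf_orderStat μ j)
    rw [this, ← integral_add i (integrable_const _)]
    congr 1
    ext x
    ring
  have h1 : (2 * (j : ℕ) : ℝ) ≤ N := by exact_mod_cast hj.1
  have h2 : (N : ℝ) ≤ 2 * (j : ℕ) + 2 := by exact_mod_cast hj.2
  have hN : (0 : ℝ) ≤ N := Nat.cast_nonneg N
  have hj0 : (0 : ℝ) ≤ (j : ℕ) := Nat.cast_nonneg _
  rw [e]
  have h3 : ((j : ℕ) + 1 : ℝ) * (j + 2) / ((N + 1) * (N + 2)) ≤ (N + 4) / (4 * (N + 1)) := by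
    rw [div_le_div_iff₀ (by positivity) (by positivity)]
    have : ((j : ℕ) + 1 : ℝ) * (j + 2) ≤ (N / 2 + 1) * (N / 2 + 2) := by gcongr <;> linarith
    nlinarith [mul_le_mul_of_nonneg_right this (show (0 : ℝ) ≤ 4 * (N + 1) by positivity)]
  have h4 : (N : ℝ) / (2 * (N + 1)) ≤ ((j : ℕ) + 1) / (N + 1) := by
    rw [div_le_div_iff₀ (by positivity) (by positivity)]
    nlinarith
  have h5 : (N + 4 : ℝ) / (4 * (N + 1)) - N / (2 * (N + 1)) + 1 / 4 = 5 / (4 * (N + 1)) := by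
    field_simp
    ring
  have h6 : (N : ℝ) * (5 / (4 * (N + 1))) ≤ 2 := by
    rw [mul_div_assoc', div_le_iff₀ (by positivity)]
    linarith
  refine le_trans ?_ h6
  gcongr
  linarith

/-- Order statistics in the middle of the sample leave a neighbourhood of the median with
exponentially small probability. -/
lemma exists_pi_real_lt_abs_orderStat_sub_le {m f : ℝ} (hm : cdf μ m = 1 / 2) (hf : 0 < f)
    (hd : HasDerivAt (cdf μ) f m) {δ : ℝ} (hδ : 0 < δ) :
    ∃ ρ : ℝ, 0 ≤ ρ ∧ ρ < 1 ∧ ∀ (N : ℕ) (j : Fin N), IsMiddle j →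
      (Measure.pi fun _ : Fin N => μ).real {x | δ < |orderStat x j - m|} ≤ 2 * ρ ^ N := by
  -- A positive derivative separates the values from `1 / 2` on both sides close to `m` only;
  -- monotonicity carries this out to `m ± δ`.
  have hlt : ∀ᶠ x in 𝓝 m, (x < m → cdf μ x < cdf μ m) ∧ (m < x → cdf μ m < cdf μ x) := by
    have hs := hasDerivAt_iff_tendsto_slope.1 hd
    have := (hs.eventually (lt_mem_nhds hf))
    rw [eventually_nhdsWithin_iff] at this
    filter_upwards [this] with x hx
    constructor
    · intro h
      have h1 := hx h.ne
      rw [slope_def_field, div_pos_iff] at h1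
      rcases h1 with h1 | h1 <;> linarith
    · intro h
      have h1 := hx h.ne'
      rw [slope_def_field, div_pos_iff] at h1
      rcases h1 with h1 | h1 <;> linarith
  obtain ⟨η, hη, hball⟩ := Metric.eventually_nhds_iff.1 hlt
  have hmin : 0 < min δ (η / 2) := by positivity
  have hηlt : min δ (η / 2) < η := (min_le_right _ _).trans_lt (by linarith)
  have hup : 1 / 2 < cdf μ (m + δ) := by
    rw [← hm]
    refine ((hball (y := m + min δ (η / 2)) ?_).2 (by linarith)).trans_le
      (monotone_cdf μ (by have := min_le_left δ (η / 2); linarith))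
    rw [Real.dist_eq, add_sub_cancel_left, abs_of_pos hmin]; exact hηlt
  have hlo : cdf μ (m - δ) < 1 / 2 := by
    rw [← hm]
    refine (monotone_cdf μ (by have := min_le_left δ (η / 2); linarith)).trans_lt
      ((hball (y := m - min δ (η / 2)) ?_).1 (by linarith))
    rw [Real.dist_eq, sub_sub_cancel_left, abs_neg, abs_of_pos hmin]; exact hηlt
  set a := 2 * √(cdf μ (m + δ) * (1 - cdf μ (m + δ)))
  set b := 2 * √(cdf μ (m - δ) * (1 - cdf μ (m - δ)))
  have ha : 0 ≤ a := by positivity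
  have hb : 0 ≤ b := by positivity
  refine ⟨max a b, le_max_of_le_left ha,
    max_lt (two_mul_sqrt_lt_one hup.ne') (two_mul_sqrt_lt_one hlo.ne), fun N j hj => ?_⟩
  have hsub : {x : Fin N → ℝ | δ < |orderStat x j - m|} ⊆
      {x | m + δ < orderStat x j} ∪ {x | orderStat x j ≤ m - δ} := by
    intro x hx
    rcases lt_abs.1 (show δ < |orderStat x j - m| from hx) with h | h
    · left; show m + δ < _; linarith
    · right; show _ ≤ m - δ; linarith
  have e1 := pi_real_lt_orderStat_le μ j hj.1 (t := m + δ) (by rw [← cdf_eq_real]; exact hup.le)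
  have e2 := pi_real_orderStat_le_le μ j hj.2 (t := m - δ) (by rw [← cdf_eq_real]; exact hlo.le)
  rw [← cdf_eq_real] at e1 e2
  have e3 : a ^ N ≤ max a b ^ N := by gcongr; exact le_max_left _ _
  have e4 : b ^ N ≤ max a b ^ N := by gcongr; exact le_max_right _ _
  calc _ ≤ _ := measureReal_mono hsub
    _ ≤ _ := measureReal_union_le _ _
    _ ≤ a ^ N + b ^ N := add_le_add e1 e2
    _ ≤ 2 * max a b ^ N := by linarith

end CentralOrderStatistics

/-! ### Negligibility of the remainder and of the middle gap -/

section Remainders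

variable (μ : Measure ℝ) [IsProbabilityMeasure μ]

lemma tendsto_zero_of_forall_le_add {a : ℕ → ℝ} (h0 : ∀ n, 0 ≤ a n)
    (h : ∀ ε > 0, ∃ b : ℕ → ℝ, Tendsto b atTop (𝓝 0) ∧ ∀ᶠ n in atTop, a n ≤ ε + b n) :
    Tendsto a atTop (𝓝 0) := by
  rw [Metric.tendsto_atTop']
  intro ε hε
  obtain ⟨b, hb, hab⟩ := h (ε / 2) (by positivity)
  have := hb.eventually_lt_const (show (0 : ℝ) < ε / 2 by positivity)
  obtain ⟨n, hn⟩ := eventually_atTop.1 (hab.and this)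
  refine ⟨n, fun k hk => ?_⟩
  obtain ⟨h1, h2⟩ := hn k hk.le
  rw [Real.dist_eq, sub_zero, abs_of_nonneg (h0 k)]
  linarith

lemma tendsto_succ_pow_mul_pow {ρ : ℝ} (h0 : 0 ≤ ρ) (h1 : ρ < 1) (k : ℕ) :
    Tendsto (fun n : ℕ => ((n + 1 : ℕ) : ℝ) ^ k * ρ ^ (n + 1)) atTop (𝓝 0) :=
  (tendsto_pow_const_mul_const_pow_of_lt_one k h0 h1).comp (tendsto_add_atTop_nat 1)

/-- Near `m`, `r ^ 2` is at most `ε / 2` times a quantity of mean at most `2 / N`. Far from `m`, `y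
≤ y ^ 2 / c + c` with `y = r ^ 2` and `c = N ^ 3`: as the mean of `r ^ 4` is at most `N * K`, the
first term contributes `K / N` after multiplication by `N`, and the second `N ^ 4` times an
exponentially small probability. -/
lemma tendsto_mul_integral_remainder_sq (hF : Continuous (cdf μ)) {m f : ℝ}
    (hm : cdf μ m = 1 / 2) (hf : 0 < f) (hd : HasDerivAt (cdf μ) f m) {r : ℝ → ℝ}
    (hr : Measurable r) (hr4 : Integrable (fun x => r x ^ 4) μ)
    (hro : ∀ ε > 0, ∀ᶠ x in 𝓝 m, |r x| ≤ ε * |cdf μ x - 1 / 2|)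
    (j : ∀ n, Fin (n + 1)) (hj : ∀ n, IsMiddle (j n)) :
    Tendsto (fun n => ((n + 1 : ℕ) : ℝ) * ∫ x, r (orderStat x (j n)) ^ 2
      ∂(Measure.pi fun _ : Fin (n + 1) => μ)) atTop (𝓝 0) := by
  refine tendsto_zero_of_forall_le_add (fun n => by positivity) fun ε hε => ?_
  obtain ⟨δ', hδ', hball⟩ := Metric.eventually_nhds_iff.1 (hro √(ε / 2) (by positivity))
  obtain ⟨δ, hδ, hδlt⟩ := exists_between hδ'
  obtain ⟨ρ, hρ0, hρ1, hρ⟩ := exists_pi_real_lt_abs_orderStat_sub_le μ hm hf hd hδ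
  set K := ∫ x, r x ^ 4 ∂μ
  refine ⟨fun n => K * (1 / ((n + 1 : ℕ) : ℝ)) + 2 * (((n + 1 : ℕ) : ℝ) ^ 4 * ρ ^ (n + 1)), ?_,
    Eventually.of_forall fun n => ?_⟩
  · have h1 : Tendsto (fun n : ℕ => (1 / ((n + 1 : ℕ) : ℝ))) atTop (𝓝 0) := by
      exact_mod_cast tendsto_one_div_add_atTop_nhds_zero_nat (𝕜 := ℝ)
    simpa using (h1.const_mul K).add ((tendsto_succ_pow_mul_pow hρ0 hρ1 4).const_mul 2)
  set M : ℝ := ((n + 1 : ℕ) : ℝ)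
  have hM : 0 < M := by positivity
  set P := Measure.pi fun _ : Fin (n + 1) => μ
  set far := {x : Fin (n + 1) → ℝ | δ < |orderStat x (j n) - m|}
  have hfar : MeasurableSet far :=
    measurableSet_lt measurable_const ((measurable_orderStat (j n)).sub_const m).abs
  have hpt : ∀ x : Fin (n + 1) → ℝ, r (orderStat x (j n)) ^ 2 ≤
      ε / 2 * (cdf μ (orderStat x (j n)) - 1 / 2) ^ 2 +
        (M ^ 3)⁻¹ * r (orderStat x (j n)) ^ 4 + M ^ 3 * far.indicator 1 x := by
    intro x
    by_cases hx : x ∈ far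
    · rw [Set.indicator_of_mem hx, Pi.one_apply]
      have h1 : 0 ≤ ε / 2 * (cdf μ (orderStat x (j n)) - 1 / 2) ^ 2 := by positivity
      have h2 : r (orderStat x (j n)) ^ 2 ≤ (M ^ 3)⁻¹ * r (orderStat x (j n)) ^ 4 + M ^ 3 := by
        set y := r (orderStat x (j n)) ^ 2
        have e : r (orderStat x (j n)) ^ 4 = y ^ 2 := by simp only [y]; ring
        have hc : 0 < M ^ 3 := by positivity
        rw [e, ← sub_nonneg]
        have : (M ^ 3)⁻¹ * y ^ 2 + M ^ 3 - y = (M ^ 3)⁻¹ * ((y - M ^ 3 / 2) ^ 2 +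
          3 / 4 * (M ^ 3) ^ 2) := by
          field_simp
          ring
        rw [this]
        positivity
      linarith
    · rw [Set.indicator_of_notMem hx]
      have hx' : |orderStat x (j n) - m| ≤ δ := not_lt.1 hx
      have h1 := hball (y := orderStat x (j n)) (by rw [Real.dist_eq]; linarith)
      have h2 : r (orderStat x (j n)) ^ 2 ≤ ε / 2 * (cdf μ (orderStat x (j n)) - 1 / 2) ^ 2 := by
        rw [← sq_abs, ← sq_abs (cdf μ _ - 1 / 2)]
        calc _ ≤ (√(ε / 2) * |cdf μ (orderStat x (j n)) - 1 / 2|) ^ 2 := by gcongr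
          _ = _ := by rw [mul_pow, Real.sq_sqrt (by positivity)]
      have h3 : 0 ≤ (M ^ 3)⁻¹ * r (orderStat x (j n)) ^ 4 := by positivity
      linarith
  have i1 : Integrable (fun x : Fin (n + 1) → ℝ => (cdf μ (orderStat x (j n)) - 1 / 2) ^ 2) P :=
    integrable_comp_orderStat μ (((monotone_cdf μ).measurable.sub_const _).pow_const 2)
      (fun x => sq_nonneg _) (integrable_cdf_sq μ) (j n)
  have i2 : Integrable (fun x : Fin (n + 1) → ℝ => r (orderStat x (j n)) ^ 4) P :=
    integrable_comp_orderStat μ (hr.pow_const 4) (fun x => by positivity) hr4 (j n)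
  have i3 : Integrable (far.indicator (1 : (Fin (n + 1) → ℝ) → ℝ)) P :=
    (integrable_const (1 : ℝ)).indicator hfar
  have i12 : Integrable (fun x : Fin (n + 1) → ℝ =>
      ε / 2 * (cdf μ (orderStat x (j n)) - 1 / 2) ^ 2 +
        (M ^ 3)⁻¹ * r (orderStat x (j n)) ^ 4) P := (i1.const_mul _).add (i2.const_mul _)
  have hle : ∫ x, r (orderStat x (j n)) ^ 2 ∂P ≤
      ε / 2 * (∫ x, (cdf μ (orderStat x (j n)) - 1 / 2) ^ 2 ∂P) + (M ^ 3)⁻¹ * (M * K) +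
        M ^ 3 * (2 * ρ ^ (n + 1)) := by
    calc _ ≤ ∫ x, (ε / 2 * (cdf μ (orderStat x (j n)) - 1 / 2) ^ 2 +
        (M ^ 3)⁻¹ * r (orderStat x (j n)) ^ 4 + M ^ 3 * far.indicator 1 x) ∂P :=
          integral_mono_of_nonneg (Eventually.of_forall fun x => sq_nonneg _)
            (i12.add (i3.const_mul _))
            (Eventually.of_forall hpt)
      _ = ε / 2 * (∫ x, (cdf μ (orderStat x (j n)) - 1 / 2) ^ 2 ∂P) +
          (M ^ 3)⁻¹ * (∫ x, r (orderStat x (j n)) ^ 4 ∂P) + M ^ 3 * P.real far := by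
          rw [integral_add i12 (i3.const_mul _),
            integral_add (i1.const_mul _) (i2.const_mul _), integral_const_mul,
            integral_const_mul, integral_const_mul, integral_indicator_one hfar]
      _ ≤ _ := by
          gcongr
          · exact integral_comp_orderStat_le μ (hr.pow_const 4) (fun x => by positivity) hr4 (j n)
          · exact hρ _ _ (hj n)
  have hA := mul_integral_cdf_orderStat_sub_half_sq_le μ hF (hj n)
  calc _ ≤ M * _ := mul_le_mul_of_nonneg_left hle hM.le
    _ = ε / 2 * (M * ∫ x, (cdf μ (orderStat x (j n)) - 1 / 2) ^ 2 ∂P) + (K * (1 / M) +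
        2 * (M ^ 4 * ρ ^ (n + 1))) := by
        field_simp
        ring
    _ ≤ ε / 2 * 2 + (K * (1 / M) + 2 * (M ^ 4 * ρ ^ (n + 1))) := by gcongr
    _ = _ := by ring

/-- The gap `D` lies in `[0, 1]`. When both order statistics are near `m`, `D ^ 2 ≤ ε * D`, and `D`
has mean at most `1 / (N + 1)`; otherwise `D ^ 2 ≤ 1` on an event of exponentially small
probability. -/
lemma tendsto_mul_integral_gap_sq (hF : Continuous (cdf μ)) {m f : ℝ}
    (hm : cdf μ m = 1 / 2) (hf : 0 < f) (hd : HasDerivAt (cdf μ) f m)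
    (j k : ∀ n, Fin (n + 1)) (hj : ∀ n, IsMiddle (j n)) (hk : ∀ n, IsMiddle (k n))
    (hjk : ∀ n, j n ≤ k n) (hkj : ∀ n, (k n : ℕ) ≤ j n + 1) :
    Tendsto (fun n => ((n + 1 : ℕ) : ℝ) * ∫ x, (cdf μ (orderStat x (k n)) -
      cdf μ (orderStat x (j n))) ^ 2 ∂(Measure.pi fun _ : Fin (n + 1) => μ)) atTop (𝓝 0) := by
  refine tendsto_zero_of_forall_le_add (fun n => by positivity) fun ε hε => ?_
  obtain ⟨δ', hδ', hball⟩ := Metric.continuousAt_iff.1 (hF.continuousAt (x := m)) (ε / 2)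
    (by positivity)
  obtain ⟨δ, hδ, hδlt⟩ := exists_between hδ'
  obtain ⟨ρ, hρ0, hρ1, hρ⟩ := exists_pi_real_lt_abs_orderStat_sub_le μ hm hf hd hδ
  refine ⟨fun n => 4 * (((n + 1 : ℕ) : ℝ) ^ 1 * ρ ^ (n + 1)), ?_, Eventually.of_forall fun n => ?_⟩
  · simpa using (tendsto_succ_pow_mul_pow hρ0 hρ1 1).const_mul 4
  set M : ℝ := ((n + 1 : ℕ) : ℝ) with hMdef
  have hM : 0 < M := by positivity
  set P := Measure.pi fun _ : Fin (n + 1) => μ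
  let far (i : Fin (n + 1)) := {x : Fin (n + 1) → ℝ | δ < |orderStat x i - m|}
  have hfar : ∀ i, MeasurableSet (far i) := fun i =>
    measurableSet_lt measurable_const ((measurable_orderStat i).sub_const m).abs
  have hnear : ∀ i x, x ∉ far i → |cdf μ (orderStat x i) - 1 / 2| < ε / 2 := by
    intro i x hx
    have hx' : |orderStat x i - m| ≤ δ := not_lt.1 hx
    have := hball (x := orderStat x i) (by rw [Real.dist_eq]; linarith)
    rwa [hm, Real.dist_eq] at this
  have hpt : ∀ x : Fin (n + 1) → ℝ, (cdf μ (orderStat x (k n)) - cdf μ (orderStat x (j n))) ^ 2 ≤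
      ε * (cdf μ (orderStat x (k n)) - cdf μ (orderStat x (j n))) +
        ((far (j n)).indicator 1 x + (far (k n)).indicator 1 x) := by
    intro x
    have h0 : 0 ≤ cdf μ (orderStat x (k n)) - cdf μ (orderStat x (j n)) :=
      sub_nonneg.2 (monotone_cdf μ (orderStat_mono x (hjk n)))
    have h1 : cdf μ (orderStat x (k n)) - cdf μ (orderStat x (j n)) ≤ 1 := by
      have := cdf_le_one μ (orderStat x (k n))
      have := cdf_nonneg μ (orderStat x (j n))
      linarith
    have hi : ∀ i, 0 ≤ (far i).indicator (1 : (Fin (n + 1) → ℝ) → ℝ) x := fun i =>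
      Set.indicator_nonneg (fun _ _ => zero_le_one) x
    by_cases hxj : x ∈ far (j n)
    · rw [Set.indicator_of_mem hxj, Pi.one_apply]
      nlinarith [hi (k n), mul_nonneg hε.le h0]
    by_cases hxk : x ∈ far (k n)
    · rw [Set.indicator_of_mem hxk, Pi.one_apply]
      nlinarith [hi (j n), mul_nonneg hε.le h0]
    have h2 := abs_lt.1 (hnear _ x hxj)
    have h3 := abs_lt.1 (hnear _ x hxk)
    have h4 : cdf μ (orderStat x (k n)) - cdf μ (orderStat x (j n)) ≤ ε := by linarith
    nlinarith [hi (j n), hi (k n)]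
  have i1 : Integrable (fun x : Fin (n + 1) → ℝ =>
      cdf μ (orderStat x (k n)) - cdf μ (orderStat x (j n))) P :=
    (integrable_cdf_orderStat μ (k n)).sub (integrable_cdf_orderStat μ (j n))
  have i2 : ∀ i, Integrable ((far i).indicator (1 : (Fin (n + 1) → ℝ) → ℝ)) P := fun i =>
    (integrable_const (1 : ℝ)).indicator (hfar i)
  have i22 : Integrable (fun x => (far (j n)).indicator (1 : (Fin (n + 1) → ℝ) → ℝ) x +
      (far (k n)).indicator 1 x) P := (i2 _).add (i2 _)
  have hle : ∫ x, (cdf μ (orderStat x (k n)) - cdf μ (orderStat x (j n))) ^ 2 ∂P ≤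
      ε * (1 / (M + 1)) + (2 * ρ ^ (n + 1) + 2 * ρ ^ (n + 1)) := by
    calc _ ≤ ∫ x, (ε * (cdf μ (orderStat x (k n)) - cdf μ (orderStat x (j n))) +
        ((far (j n)).indicator 1 x + (far (k n)).indicator 1 x)) ∂P :=
          integral_mono_of_nonneg (Eventually.of_forall fun x => sq_nonneg _)
            ((i1.const_mul _).add i22) (Eventually.of_forall hpt)
      _ = ε * ((((k n : ℕ) : ℝ) + 1) / (M + 1) - (((j n : ℕ) : ℝ) + 1) / (M + 1)) +
          (P.real (far (j n)) + P.real (far (k n))) := by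
          rw [integral_add (i1.const_mul _) i22, integral_add (i2 _) (i2 _),
            integral_const_mul, integral_sub (integrable_cdf_orderStat μ (k n))
              (integrable_cdf_orderStat μ (j n)), integral_cdf_orderStat μ hF,
            integral_cdf_orderStat μ hF, integral_indicator_one (hfar _),
            integral_indicator_one (hfar _)]
      _ ≤ _ := by
          gcongr
          · rw [← sub_div]
            gcongr
            have : ((k n : ℕ) : ℝ) ≤ (j n : ℕ) + 1 := by exact_mod_cast hkj n
            linarith
          · exact hρ _ _ (hj n)
          · exact hρ _ _ (hk n)
  calc _ ≤ M * _ := mul_le_mul_of_nonneg_left hle hM.le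
    _ = ε * (M / (M + 1)) + 4 * (M ^ 1 * ρ ^ (n + 1)) := by ring
    _ ≤ ε * 1 + 4 * (M ^ 1 * ρ ^ (n + 1)) := by
        gcongr
        rw [div_le_one (by positivity)]
        linarith
    _ = _ := by ring

end Remainders

/-! ### Asymptotic variance of the sample median -/

section SampleMedian

variable (μ : Measure ℝ)

/-- The variance of the sample median of `N` independent observations with law `μ`. -/
noncomputable def medianVariance (N : ℕ) : ℝ :=
  if h : N = 0 then 0 else
    haveI : NeZero N := ⟨h⟩
    Var[fun x : Fin N → ℝ => sampleMedian x; Measure.pi fun _ => μ]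

lemma medianVariance_eq (N : ℕ) [h : NeZero N] :
    medianVariance μ N = Var[fun x : Fin N → ℝ => sampleMedian x; Measure.pi fun _ => μ] := by
  rw [medianVariance, dif_neg h.out]

lemma memLp_sampleMedian [IsProbabilityMeasure μ] {N : ℕ} [NeZero N]
    (h2 : Integrable (fun x => x ^ 2) μ) :
    MemLp (fun x : Fin N → ℝ => sampleMedian x) 2 (Measure.pi fun _ => μ) := by
  have h := fun j : Fin N => memLp_comp_orderStat μ measurable_id h2 j
  simp_rw [sampleMedian_eq, div_eq_inv_mul]
  exact ((h _).add (h _)).const_mul 2⁻¹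

/-- The lower of the two middle positions of a sample of size `n + 1`. -/
def lowerMiddle (n : ℕ) : Fin (n + 1) := ⟨(n + 1 - 1) / 2, by omega⟩

/-- The upper of the two middle positions of a sample of size `n + 1`. -/
def upperMiddle (n : ℕ) : Fin (n + 1) := ⟨(n + 1) / 2, by omega⟩

lemma isMiddle_lowerMiddle (n : ℕ) : IsMiddle (lowerMiddle n) := by
  simp only [IsMiddle, lowerMiddle]; omega

lemma isMiddle_upperMiddle (n : ℕ) : IsMiddle (upperMiddle n) := by
  simp only [IsMiddle, upperMiddle]; omega

/-- With `N = n + 1` the Beta variance is `(j + 1) * (N - j) / ((N + 1) ^ 2 * (N + 2))`, and `j / N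
→ 1 / 2`. -/
lemma tendsto_mul_variance_cdf_orderStat [IsProbabilityMeasure μ] (hF : Continuous (cdf μ))
    (j : ∀ n, Fin (n + 1)) (hj : ∀ n, IsMiddle (j n)) :
    Tendsto (fun n => ((n + 1 : ℕ) : ℝ) * Var[fun x => cdf μ (orderStat x (j n));
      Measure.pi fun _ : Fin (n + 1) => μ]) atTop (𝓝 (1 / 4)) := by
  have hinv : Tendsto (fun n : ℕ => (1 : ℝ) / (n + 1)) atTop (𝓝 0) :=
    tendsto_one_div_add_atTop_nhds_zero_nat
  have hjlim : Tendsto (fun n => ((j n : ℕ) : ℝ) * (1 / (n + 1))) atTop (𝓝 (1 / 2)) := by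
    have hlo : Tendsto (fun n : ℕ => (1 : ℝ) / 2 - 1 / (n + 1)) atTop (𝓝 (1 / 2)) := by
      simpa using hinv.const_sub (1 / 2 : ℝ)
    refine tendsto_of_tendsto_of_tendsto_of_le_of_le hlo tendsto_const_nhds (fun n => ?_)
      fun n => ?_
    · have h2 : ((n : ℝ) + 1) ≤ 2 * (j n : ℕ) + 2 := by exact_mod_cast (hj n).2
      have : (0 : ℝ) < n + 1 := by positivity
      rw [← sub_nonneg]
      have e : ((j n : ℕ) : ℝ) * (1 / (n + 1)) - (1 / 2 - 1 / (n + 1)) =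
        (2 * (j n : ℕ) + 2 - (n + 1)) * (1 / (2 * (n + 1))) := by field_simp; ring
      rw [e]
      exact mul_nonneg (by linarith) (by positivity)
    · have h1 : (2 * (j n : ℕ) : ℝ) ≤ n + 1 := by exact_mod_cast (hj n).1
      have : (0 : ℝ) < n + 1 := by positivity
      rw [mul_one_div, div_le_iff₀ this]
      linarith
  have hlim : Tendsto (fun n : ℕ => (((j n : ℕ) : ℝ) * (1 / (n + 1)) + 1 / (n + 1)) *
      (1 + 1 / (n + 1) - (((j n : ℕ) : ℝ) * (1 / (n + 1)) + 1 / (n + 1))) /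
      ((1 + 1 / (n + 1)) ^ 2 * (1 + 2 * (1 / (n + 1))))) atTop
      (𝓝 ((1 / 2 + 0) * (1 + 0 - (1 / 2 + 0)) / ((1 + 0) ^ 2 * (1 + 2 * 0)))) := by
    refine Tendsto.div (((hjlim.add hinv)).mul ((hinv.const_add 1).sub (hjlim.add hinv)))
      (((hinv.const_add 1).pow 2).mul ((hinv.const_mul 2).const_add 1)) (by norm_num)
  norm_num at hlim
  rw [show (1 / 4 : ℝ) = 1 / 2 * (1 / 2) by norm_num]
  norm_num
  refine hlim.congr fun n => ?_
  rw [variance_eq_sub (memLp_cdf_orderStat μ (j n))]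
  have e1 := integral_cdf_orderStat_sq μ hF (j n)
  have e2 := integral_cdf_orderStat μ hF (j n)
  simp only [Pi.pow_apply]
  rw [e1, e2]
  push_cast
  have : (0 : ℝ) < n + 1 := by positivity
  field_simp
  ring

/-- The error of the linear approximation of `x - m` by `f⁻¹ * (cdf μ x - 1 / 2)`. -/
noncomputable def cdfRemainder (m f x : ℝ) : ℝ := x - m - f⁻¹ * (cdf μ x - 1 / 2)

lemma measurable_cdfRemainder (m f : ℝ) : Measurable (cdfRemainder μ m f) := by
  have := (monotone_cdf μ).measurable
  unfold cdfRemainder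
  fun_prop

/-- The remainder is `-f⁻¹` times the Taylor error of the distribution function at `m`. An error
below `f / 2 * |x - m|` forces `|cdf μ x - 1 / 2| ≥ f / 2 * |x - m|`, so smallness relative to `x -
m` becomes smallness relative to `cdf μ x - 1 / 2`. -/
lemma eventually_abs_cdfRemainder_le {m f : ℝ} (hm : cdf μ m = 1 / 2) (hf : 0 < f)
    (hd : HasDerivAt (cdf μ) f m) {ε : ℝ} (hε : 0 < ε) :
    ∀ᶠ x in 𝓝 m, |cdfRemainder μ m f x| ≤ ε * |cdf μ x - 1 / 2| := by
  have ho := hasDerivAt_iff_isLittleO.1 hd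
  have hη : 0 < min (f / 2) (ε * f * f / 2) := by positivity
  filter_upwards [ho.def hη] with x hx
  rw [hm, Real.norm_eq_abs, Real.norm_eq_abs, smul_eq_mul] at hx
  have h1 : |cdf μ x - 1 / 2 - (x - m) * f| ≤ f / 2 * |x - m| :=
    hx.trans (by gcongr; exact min_le_left _ _)
  have h2 : |cdf μ x - 1 / 2 - (x - m) * f| ≤ ε * f * f / 2 * |x - m| :=
    hx.trans (by gcongr; exact min_le_right _ _)
  have h3 : f / 2 * |x - m| ≤ |cdf μ x - 1 / 2| := by
    have h4 : |x - m| * f ≤ |cdf μ x - 1 / 2| + |cdf μ x - 1 / 2 - (x - m) * f| := by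
      rw [← abs_of_pos hf, ← abs_mul, abs_of_pos hf]
      have := abs_sub (cdf μ x - 1 / 2) (cdf μ x - 1 / 2 - (x - m) * f)
      rwa [sub_sub_cancel] at this
    nlinarith
  have e : cdfRemainder μ m f x = -(f⁻¹ * (cdf μ x - 1 / 2 - (x - m) * f)) := by
    rw [cdfRemainder]
    field_simp
    ring
  rw [e, abs_neg, abs_mul, abs_of_pos (inv_pos.2 hf)]
  calc f⁻¹ * |cdf μ x - 1 / 2 - (x - m) * f| ≤ f⁻¹ * (ε * f * f / 2 * |x - m|) := by gcongr
    _ = ε * (f / 2 * |x - m|) := by field_simp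
    _ ≤ _ := by gcongr

lemma integrable_cdfRemainder_pow_four [IsProbabilityMeasure μ] (m f : ℝ)
    (h4 : Integrable (fun x => x ^ 4) μ) :
    Integrable (fun x => cdfRemainder μ m f x ^ 4) μ := by
  have hb : Integrable (fun x => 8 * x ^ 4 + 8 * (|m| + |f⁻¹|) ^ 4) μ :=
    (h4.const_mul 8).add (integrable_const _)
  refine hb.mono' ((measurable_cdfRemainder μ m f).pow_const 4).aestronglyMeasurable
    (Eventually.of_forall fun x => ?_)
  rw [Real.norm_of_nonneg (by positivity)]
  have h0 := cdf_nonneg μ x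
  have h1 := cdf_le_one μ x
  have hc : |cdf μ x - 1 / 2| ≤ 1 := by rw [abs_le]; constructor <;> linarith
  have h2 : |cdfRemainder μ m f x| ≤ |x| + (|m| + |f⁻¹|) := by
    rw [cdfRemainder]
    calc _ ≤ |x - m| + |f⁻¹ * (cdf μ x - 1 / 2)| := abs_sub _ _
      _ ≤ (|x| + |m|) + |f⁻¹| * 1 := by
        gcongr
        · exact abs_sub _ _
        · rw [abs_mul]; gcongr
      _ = _ := by ring
  rw [← Even.pow_abs (by decide : Even 4), ← Even.pow_abs (by decide : Even 4) x]
  calc _ ≤ (|x| + (|m| + |f⁻¹|)) ^ 4 := by gcongr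
    _ ≤ 8 * |x| ^ 4 + 8 * (|m| + |f⁻¹|) ^ 4 := by
      have := add_pow_le (abs_nonneg x) (show 0 ≤ |m| + |f⁻¹| by positivity) 4
      rw [show (2 : ℝ) ^ (4 - 1) = 8 by norm_num] at this
      linarith

lemma integrable_sq_of_integrable_pow_four {Ω : Type*} [MeasurableSpace Ω] {P : Measure Ω}
    [IsFiniteMeasure P] {X : Ω → ℝ} (hX : AEStronglyMeasurable X P)
    (h4 : Integrable (fun ω => X ω ^ 4) P) : Integrable (fun ω => X ω ^ 2) P := by
  refine (h4.add (integrable_const 1)).mono' (hX.pow 2) (Eventually.of_forall fun ω => ?_)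
  rw [Real.norm_of_nonneg (by positivity)]
  simp only [Pi.add_apply]
  nlinarith [sq_nonneg (X ω ^ 2 - 1 / 2)]

lemma tendsto_add_of_covariance_sq_le {a b c d : ℕ → ℝ} {A : ℝ} (ha : Tendsto a atTop (𝓝 A))
    (hb : Tendsto b atTop (𝓝 0)) (hc : ∀ n, c n ^ 2 ≤ a n * b n)
    (hd : ∀ n, d n = a n + 2 * c n + b n) : Tendsto d atTop (𝓝 A) := by
  have h1 : Tendsto (fun n => c n ^ 2) atTop (𝓝 0) :=
    squeeze_zero (fun n => sq_nonneg _) hc (by simpa using ha.mul hb)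
  have h2 : Tendsto c atTop (𝓝 0) := by
    have := (Real.continuous_sqrt.tendsto 0).comp h1
    simp only [Real.sqrt_zero, Function.comp_def, Real.sqrt_sq_eq_abs] at this
    exact (tendsto_zero_iff_abs_tendsto_zero _).2 this
  have := (ha.add (h2.const_mul 2)).add hb
  simp only [mul_zero, add_zero] at this
  exact this.congr fun n => (hd n).symm

/-- The asymptotic variance of the sample median. -/
theorem tendsto_mul_medianVariance [IsProbabilityMeasure μ] (hF : Continuous (cdf μ)) {m f : ℝ}
    (hm : cdf μ m = 1 / 2) (hf : 0 < f) (hd : HasDerivAt (cdf μ) f m)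
    (h4 : Integrable (fun x => x ^ 4) μ) :
    Tendsto (fun N : ℕ => (N : ℝ) * medianVariance μ N) atTop (𝓝 (1 / (4 * f ^ 2))) := by
  rw [← tendsto_add_atTop_iff_nat 1]
  set r := cdfRemainder μ m f
  have hrm : Measurable r := measurable_cdfRemainder μ m f
  have hr4 : Integrable (fun x => r x ^ 4) μ := integrable_cdfRemainder_pow_four μ m f h4
  have hr2 := integrable_sq_of_integrable_pow_four hrm.aestronglyMeasurable hr4
  let U (n : ℕ) (j : Fin (n + 1)) (x : Fin (n + 1) → ℝ) : ℝ := cdf μ (orderStat x j)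
  -- Up to a constant the median is `L + R`: `L` is the linear term at the lower middle position,
  -- `R` the average of the two remainders plus half the scaled gap.
  let L (n : ℕ) (x : Fin (n + 1) → ℝ) : ℝ := f⁻¹ * U n (lowerMiddle n) x
  let R (n : ℕ) (x : Fin (n + 1) → ℝ) : ℝ := 2⁻¹ * (r (orderStat x (lowerMiddle n)) +
    r (orderStat x (upperMiddle n))) + f⁻¹ / 2 * (U n (upperMiddle n) x - U n (lowerMiddle n) x)
  let P (n : ℕ) : Measure (Fin (n + 1) → ℝ) := Measure.pi fun _ => μ
  have mU : ∀ n j, MemLp (U n j) 2 (P n) := fun n j => memLp_cdf_orderStat μ j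
  have mr : ∀ n (j : Fin (n + 1)), MemLp (fun x => r (orderStat x j)) 2 (P n) :=
    fun n j => memLp_comp_orderStat μ hrm hr2 j
  have mL : ∀ n, MemLp (L n) 2 (P n) := fun n => (mU n _).const_mul _
  have mR : ∀ n, MemLp (R n) 2 (P n) := fun n =>
    (((mr n _).add (mr n _)).const_mul _).add (((mU n _).sub (mU n _)).const_mul _)
  have hdecomp : ∀ n (x : Fin (n + 1) → ℝ),
      sampleMedian x = (L n + R n) x + (m - f⁻¹ * (1 / 2)) := by
    intro n x
    rw [sampleMedian_eq]
    change (orderStat x (lowerMiddle n) + orderStat x (upperMiddle n)) / 2 = _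
    simp only [Pi.add_apply, L, R, r, U, cdfRemainder]
    ring
  have hRsq : ∀ n x, R n x ^ 2 ≤ r (orderStat x (lowerMiddle n)) ^ 2 +
      r (orderStat x (upperMiddle n)) ^ 2 +
      f⁻¹ ^ 2 * (U n (upperMiddle n) x - U n (lowerMiddle n) x) ^ 2 := by
    intro n x
    simp only [R]
    set a := r (orderStat x (lowerMiddle n))
    set b := r (orderStat x (upperMiddle n))
    set D := f⁻¹ * (U n (upperMiddle n) x - U n (lowerMiddle n) x)
    have e : f⁻¹ / 2 * (U n (upperMiddle n) x - U n (lowerMiddle n) x) = D / 2 := by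
      simp only [D]; ring
    rw [e, ← mul_pow]
    nlinarith [sq_nonneg (a - b), sq_nonneg (a + b - D), sq_nonneg D]
  have hR : Tendsto (fun n => ((n + 1 : ℕ) : ℝ) * Var[R n; P n]) atTop (𝓝 0) := by
    have t1 := tendsto_mul_integral_remainder_sq μ hF hm hf hd hrm hr4
      (fun ε hε => eventually_abs_cdfRemainder_le μ hm hf hd hε) lowerMiddle isMiddle_lowerMiddle
    have t2 := tendsto_mul_integral_remainder_sq μ hF hm hf hd hrm hr4
      (fun ε hε => eventually_abs_cdfRemainder_le μ hm hf hd hε) upperMiddle isMiddle_upperMiddle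
    have t3 := tendsto_mul_integral_gap_sq μ hF hm hf hd lowerMiddle upperMiddle
      isMiddle_lowerMiddle isMiddle_upperMiddle
      (fun n => by rw [Fin.le_def]; simp only [lowerMiddle, upperMiddle]; omega)
      (fun n => by simp only [lowerMiddle, upperMiddle]; omega)
    have t := (t1.add t2).add (t3.const_mul (f⁻¹ ^ 2))
    simp only [mul_zero, add_zero] at t
    refine squeeze_zero (fun n => mul_nonneg (by positivity) (variance_nonneg _ _)) (fun n => ?_) t
    have i1 := (mr n (lowerMiddle n)).integrable_sq
    have i2 := (mr n (upperMiddle n)).integrable_sq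
    have i12 : Integrable (fun x => r (orderStat x (lowerMiddle n)) ^ 2 +
      r (orderStat x (upperMiddle n)) ^ 2) (P n) := i1.add i2
    have i3 : Integrable (fun x => (U n (upperMiddle n) x - U n (lowerMiddle n) x) ^ 2) (P n) :=
      ((mU n (upperMiddle n)).sub (mU n (lowerMiddle n))).integrable_sq
    have hle : Var[R n; P n] ≤ (∫ x, r (orderStat x (lowerMiddle n)) ^ 2 ∂(P n)) +
        (∫ x, r (orderStat x (upperMiddle n)) ^ 2 ∂(P n)) +
        f⁻¹ ^ 2 * ∫ x, (U n (upperMiddle n) x - U n (lowerMiddle n) x) ^ 2 ∂(P n) := by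
      refine (variance_le_expectation_sq (mR n).aestronglyMeasurable).trans ?_
      rw [← integral_const_mul, ← integral_add i1 i2, ← integral_add i12 (i3.const_mul _)]
      exact integral_mono (mR n).integrable_sq (i12.add (i3.const_mul _)) (hRsq n)
    refine (mul_le_mul_of_nonneg_left hle (by positivity)).trans (le_of_eq ?_)
    simp only [U, P]
    ring
  have hL : Tendsto (fun n => ((n + 1 : ℕ) : ℝ) * Var[L n; P n]) atTop (𝓝 (1 / (4 * f ^ 2))) := by
    have := (tendsto_mul_variance_cdf_orderStat μ hF lowerMiddle isMiddle_lowerMiddle).const_mul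
      (f⁻¹ ^ 2)
    have e : f⁻¹ ^ 2 * (1 / 4) = 1 / (4 * f ^ 2) := by field_simp
    rw [e] at this
    refine this.congr fun n => ?_
    simp only [L, P, U, variance_const_mul]
    ring
  refine tendsto_add_of_covariance_sq_le
    (c := fun n => ((n + 1 : ℕ) : ℝ) * cov[L n, R n; P n]) hL hR (fun n => ?_) fun n => ?_
  · have := covariance_sq_le (mL n) (mR n)
    calc _ = ((n + 1 : ℕ) : ℝ) ^ 2 * cov[L n, R n; P n] ^ 2 := by ring
      _ ≤ ((n + 1 : ℕ) : ℝ) ^ 2 * (Var[L n; P n] * Var[R n; P n]) := by gcongr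
      _ = _ := by ring
  · rw [medianVariance_eq]
    simp_rw [hdecomp]
    rw [variance_add_const ((mL n).add (mR n)).aestronglyMeasurable, variance_add (mL n) (mR n)]
    simp only [P]
    ring

end SampleMedian

/-! ### The law of the logarithm of a squared normal variable -/

section LogSquaredNormal

lemma integrable_comp_abs_of_integrableOn_Ioi {f : ℝ → ℝ} (hf : IntegrableOn f (Set.Ioi 0)) :
    Integrable fun x => f |x| := by
  have h1 : IntegrableOn (fun x => f |x|) (Set.Ioi 0) :=
    hf.congr_fun (fun x hx => by rw [abs_of_pos (by exact hx)]) measurableSet_Ioi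
  have h2 : IntegrableOn (fun x => f |x|) (Set.Iic 0) := by
    rw [← Measure.map_neg_eq_self (volume : Measure ℝ)]
    have m : MeasurableEmbedding fun x : ℝ => -x := (Homeomorph.neg ℝ).measurableEmbedding
    rw [m.integrableOn_map_iff]
    simp_rw [Function.comp_def, abs_neg, Set.neg_preimage, Set.neg_Iic, neg_zero]
    exact Iff.mpr integrableOn_Ici_iff_integrableOn_Ioi h1
  rw [← integrableOn_univ, ← Set.Iic_union_Ioi (a := (0 : ℝ))]
  exact h2.union h1

lemma integrable_abs_rpow_gaussianReal {s : ℝ} (hs : -1 < s) :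
    Integrable (fun z : ℝ => |z| ^ s) (gaussianReal 0 1) := by
  rw [gaussianReal_of_var_ne_zero 0 one_ne_zero,
    integrable_withDensity_iff_integrable_smul' (measurable_gaussianPDF _ _)
      (ae_of_all _ fun _ => gaussianPDF_lt_top)]
  have h := integrable_comp_abs_of_integrableOn_Ioi
    (integrableOn_rpow_mul_exp_neg_mul_sq (b := 1 / 2) (by norm_num) hs)
  refine (h.const_mul (√(2 * Real.pi))⁻¹).congr (ae_of_all _ fun z => ?_)
  simp only [toReal_gaussianPDF, gaussianPDFReal_zero_one, stdNormalPDF, smul_eq_mul, sq_abs]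
  ring_nf

/-- The law of `log (Z ^ 2)` for a standard normal variable `Z`. -/
noncomputable def logSqNormal : Measure ℝ :=
  (gaussianReal 0 1).map fun z => Real.log (z ^ 2)

lemma measurable_log_sq : Measurable fun z : ℝ => Real.log (z ^ 2) := by fun_prop

instance : IsProbabilityMeasure logSqNormal :=
  Measure.isProbabilityMeasure_map measurable_log_sq.aemeasurable

lemma ae_ne_zero_gaussianReal : ∀ᵐ z ∂(gaussianReal 0 1), z ≠ 0 := by
  have := nullSingletonClass_gaussianReal (μ := 0) (v := 1) one_ne_zero
  simp [ae_iff]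

lemma integrable_exp_mul_log_sq {t : ℝ} (ht : -1 < 2 * t) :
    Integrable (fun z : ℝ => Real.exp (t * Real.log (z ^ 2))) (gaussianReal 0 1) := by
  refine (integrable_abs_rpow_gaussianReal ht).congr ?_
  filter_upwards [ae_ne_zero_gaussianReal] with z hz
  rw [Real.rpow_def_of_pos (abs_pos.2 hz), Real.log_pow, Real.log_abs]
  push_cast
  ring_nf

/-- The exponential moments at `±1 / 4` are the moments of `|Z|` of order `±1 / 2`, both finite
because the order exceeds `-1`; they dominate all powers of the logarithm. -/
lemma integrable_pow_logSqNormal (n : ℕ) : Integrable (fun x => x ^ n) logSqNormal := by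
  rw [logSqNormal, integrable_map_measure (by fun_prop) measurable_log_sq.aemeasurable]
  exact integrable_pow_of_integrable_exp_mul (t := 1 / 4) (by norm_num)
    (integrable_exp_mul_log_sq (by norm_num)) (integrable_exp_mul_log_sq (by norm_num)) n

lemma cdf_logSqNormal (x : ℝ) :
    cdf logSqNormal x = 2 * cdf (gaussianReal 0 1) (Real.exp (x / 2)) - 1 := by
  set a := Real.exp (x / 2)
  have ha : 0 < a := Real.exp_pos _
  have := nullSingletonClass_gaussianReal (μ := 0) (v := 1) one_ne_zero
  have hn := cdf_gaussianReal_neg a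
  have e : Set.Iic a \ Set.Iic (-a) = Set.Ioc (-a) a := by
    ext; simp [and_comm]
  have h1 : (gaussianReal 0 1).real (Set.Ioc (-a) a) = 2 * cdf (gaussianReal 0 1) a - 1 := by
    rw [← e, measureReal_sdiff (Set.Iic_subset_Iic.2 (by linarith)) measurableSet_Iic,
      ← cdf_eq_real, ← cdf_eq_real, hn]
    ring
  rw [← h1, cdf_eq_real, logSqNormal, map_measureReal_apply measurable_log_sq measurableSet_Iic,
    measureReal_congr (Ioc_ae_eq_Icc (a := -a) (b := a))]
  refine measureReal_congr ?_
  -- The two events may differ at `z = 0`, where `Real.log` takes the default value `0`.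
  filter_upwards [ae_ne_zero_gaussianReal] with z hz
  refine propext ?_
  change Real.log (z ^ 2) ≤ x ↔ -a ≤ z ∧ z ≤ a
  rw [← abs_le, Real.log_le_iff_le_exp (by positivity), ← sq_abs,
    show Real.exp x = a ^ 2 by simp only [a]; rw [← Real.exp_nat_mul]; congr 1; push_cast; ring,
    sq_le_sq₀ (abs_nonneg z) ha.le]

lemma continuous_cdf_logSqNormal : Continuous (cdf logSqNormal) := by
  rw [show (cdf logSqNormal : ℝ → ℝ) = _ from funext cdf_logSqNormal]
  have := continuous_cdf_gaussianReal
  fun_prop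

lemma hasDerivAt_cdf_logSqNormal (x : ℝ) :
    HasDerivAt (cdf logSqNormal) (stdNormalPDF (Real.exp (x / 2)) * Real.exp (x / 2)) x := by
  rw [show (cdf logSqNormal : ℝ → ℝ) = _ from funext cdf_logSqNormal]
  have h1 : HasDerivAt (fun x : ℝ => Real.exp (x / 2)) (Real.exp (x / 2) * (1 / 2)) x :=
    ((hasDerivAt_id' x).div_const 2).exp
  have h2 := (((hasDerivAt_cdf_gaussianReal (Real.exp (x / 2))).comp x h1).const_mul 2).sub_const 1
  refine h2.congr_deriv ?_
  ring

lemma exp_half_log_medlQ : Real.exp (Real.log medlQ / 2) = stdNormalQuantile (3 / 4) := by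
  have hq := stdNormalQuantile_bounds.1
  have hq' : 0 < stdNormalQuantile (3 / 4) := by linarith
  rw [medlQ, Real.log_pow, Nat.cast_two, mul_div_cancel_left₀ _ two_ne_zero, Real.exp_log hq']

lemma cdf_logSqNormal_log_medlQ : cdf logSqNormal (Real.log medlQ) = 1 / 2 := by
  rw [cdf_logSqNormal, exp_half_log_medlQ, cdf_stdNormalQuantile (by norm_num) (by norm_num)]
  norm_num

lemma tendsto_mul_medianVariance_logSqNormal :
    Tendsto (fun N : ℕ => (N : ℝ) * medianVariance logSqNormal N) atTop
      (𝓝 (Real.pi * Real.exp medlQ / (2 * medlQ))) := by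
  have hq : 0 < stdNormalQuantile (3 / 4) := by linarith [stdNormalQuantile_bounds.1]
  have hd := hasDerivAt_cdf_logSqNormal (Real.log medlQ)
  rw [exp_half_log_medlQ] at hd
  have h := tendsto_mul_medianVariance logSqNormal continuous_cdf_logSqNormal
    cdf_logSqNormal_log_medlQ (mul_pos (stdNormalPDF_pos _) hq) hd (integrable_pow_logSqNormal 4)
  convert h using 2
  rw [medlQ, stdNormalPDF]
  set q := stdNormalQuantile (3 / 4)
  have e : Real.exp (-q ^ 2 / 2) ^ 2 = (Real.exp (q ^ 2))⁻¹ := by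
    rw [← Real.exp_nat_mul, ← Real.exp_neg]; congr 1; push_cast; ring
  have hs : √(2 * Real.pi) ^ 2 = 2 * Real.pi := Real.sq_sqrt (by positivity)
  rw [mul_pow, mul_pow, e, inv_pow, hs]
  field_simp
  ring

lemma isEquivalent_medianVariance_logSqNormal :
    Asymptotics.IsEquivalent atTop (medianVariance logSqNormal)
      (fun N : ℕ => Real.pi * Real.exp medlQ / (2 * (N : ℝ) * medlQ)) := by
  have hQ : 0 < medlQ := by
    have : 0 < stdNormalQuantile (3 / 4) := by linarith [stdNormalQuantile_bounds.1]
    unfold medlQ; positivity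
  have hA : Real.pi * Real.exp medlQ / (2 * medlQ) ≠ 0 := by positivity
  have hN : ∀ᶠ N : ℕ in atTop, 0 < N := eventually_gt_atTop 0
  refine (Asymptotics.isEquivalent_iff_tendsto_one ?_).2 ?_
  · filter_upwards [hN] with N hN
    have : (0 : ℝ) < N := by exact_mod_cast hN
    positivity
  · have h := tendsto_mul_medianVariance_logSqNormal.div_const
      (Real.pi * Real.exp medlQ / (2 * medlQ))
    rw [div_self hA] at h
    refine h.congr' ?_
    filter_upwards [hN] with N hN
    have : (0 : ℝ) < N := by exact_mod_cast hN
    simp only [Pi.div_apply]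
    field_simp

end LogSquaredNormal

/-! ### Reduction of a normal sample to the standard one -/

section GaussianSample

/-- The sample median of `log (X i ^ 2)` for independent centred normal variables with a common
variance is square integrable, and its variance depends on the sample size only. -/
theorem memLp_and_variance_sampleMedian_log_sq {Ω : Type*} [MeasurableSpace Ω] {P : Measure Ω}
    [IsProbabilityMeasure P] {N : ℕ} [NeZero N] {X : Fin N → Ω → ℝ} {v : NNReal} (hv : v ≠ 0)
    (hm : ∀ i, AEMeasurable (X i) P) (hX : ∀ i, P.map (X i) = gaussianReal 0 v)
    (hind : iIndepFun X P) :
    MemLp (fun ω => sampleMedian fun i => Real.log (X i ω ^ 2)) 2 P ∧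
      Var[fun ω => sampleMedian fun i => Real.log (X i ω ^ 2); P] =
        medianVariance logSqNormal N := by
  set s : ℝ := √v
  have hs : 0 < s := Real.sqrt_pos.2 (by exact_mod_cast pos_iff_ne_zero.2 hv)
  have hss : s ^ 2 = v := Real.sq_sqrt v.2
  let Y (i : Fin N) (ω : Ω) : ℝ := Real.log ((X i ω / s) ^ 2)
  have hg : Measurable fun x : ℝ => Real.log ((x / s) ^ 2) := by fun_prop
  have hYm : ∀ i, AEMeasurable (Y i) P := fun i => hg.comp_aemeasurable (hm i)
  have hYlaw : ∀ i, P.map (Y i) = logSqNormal := by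
    intro i
    have h1 : P.map (fun ω => X i ω / s) = gaussianReal 0 1 := by
      have : (P.map (X i)).map (fun x => x / s) = gaussianReal 0 1 := by
        rw [hX i, gaussianReal_map_div_const]
        congr 1
        · simp
        · ext
          simp [hss, hv]
      rw [← this, AEMeasurable.map_map_of_aemeasurable (by fun_prop) (hm i)]
      rfl
    rw [logSqNormal, ← h1, AEMeasurable.map_map_of_aemeasurable (by fun_prop)
      ((hm i).div_const s)]
    rfl
  have hYind : iIndepFun Y P := hind.comp (fun _ x => Real.log ((x / s) ^ 2)) fun _ => hg
  have hlaw : P.map (fun ω i => Y i ω) = Measure.pi fun _ : Fin N => logSqNormal := by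
    rw [(iIndepFun_iff_map_fun_eq_pi_map hYm).1 hYind]
    simp_rw [hYlaw]
  have hvec : AEMeasurable (fun ω i => Y i ω) P := aemeasurable_pi_lambda _ hYm
  have hae : (fun ω => sampleMedian fun i => Real.log (X i ω ^ 2)) =ᵐ[P]
      fun ω => (sampleMedian fun i => Y i ω) + Real.log v := by
    -- The logarithm of the quotient splits only where no observation vanishes.
    have hne : ∀ i, ∀ᵐ ω ∂P, X i ω ≠ 0 := by
      intro i
      have := nullSingletonClass_gaussianReal (μ := 0) (v := v) hv
      have h : ∀ᵐ x ∂(P.map (X i)), x ≠ 0 := by rw [hX i]; simp [ae_iff]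
      exact ae_of_ae_map (hm i) h
    filter_upwards [ae_all_iff.2 hne] with ω hω
    rw [← sampleMedian_add_const]
    congr 1
    ext i
    have h1 : X i ω ^ 2 ≠ 0 := pow_ne_zero 2 (hω i)
    have h2 : (v : ℝ) ≠ 0 := by exact_mod_cast hv
    simp only [Y]
    rw [div_pow, hss, Real.log_div h1 h2]
    ring
  have hL := memLp_sampleMedian logSqNormal (N := N) (integrable_pow_logSqNormal 2)
  rw [← hlaw] at hL
  have hL' : MemLp (fun ω => sampleMedian fun i => Y i ω) 2 P := hL.comp_of_map hvec
  refine ⟨(memLp_congr_ae hae).2 (hL'.add (memLp_const _)), ?_⟩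
  rw [variance_congr hae, variance_add_const hL'.aestronglyMeasurable, medianVariance_eq, ← hlaw,
    variance_map hL.aemeasurable hvec]
  rfl

end GaussianSample

/-! ### Replacing the process by one with continuous paths everywhere -/

section Modification

/-- A process with almost surely continuous paths coincides, outside a null set and simultaneously
for all times, with a process that is measurable at each time and has continuous paths. -/
lemma exists_measurable_continuous_modification {Ω : Type*} [MeasurableSpace Ω] {P : Measure Ω}
    {B : ℝ → Ω → ℝ} (hm : ∀ t, AEMeasurable (B t) P)
    (hc : ∀ᵐ ω ∂P, Continuous fun t => B t ω) :
    ∃ B' : ℝ → Ω → ℝ, (∀ t, Measurable (B' t)) ∧ (∀ ω, Continuous fun t => B' t ω) ∧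
      ∀ᵐ ω ∂P, ∀ t, B t ω = B' t ω := by
  -- Only rational times are used, so that the exceptional null sets are countably many; continuity
  -- then gives measurability at real times.
  have hq : ∀ᵐ ω ∂P, ∀ q : ℚ, B q ω = (hm q).mk _ ω := ae_all_iff.2 fun q => (hm q).ae_eq_mk
  have hgood := hc.and hq
  obtain ⟨T, hT, hTm, hT0⟩ := exists_measurable_superset_of_null (ae_iff.1 hgood)
  have hsub : ∀ ω ∈ Tᶜ, Continuous (fun t => B t ω) ∧ ∀ q : ℚ, B q ω = (hm q).mk _ ω := by
    intro ω hω
    by_contra h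
    exact hω (hT h)
  have hcont : ∀ ω, Continuous fun t => Tᶜ.indicator (B t) ω := by
    intro ω
    by_cases hω : ω ∈ Tᶜ
    · simpa only [Set.indicator_of_mem hω] using (hsub ω hω).1
    · simpa only [Set.indicator_of_notMem hω] using continuous_const
  have hrat : ∀ q : ℚ, Measurable (Tᶜ.indicator (B q)) := by
    intro q
    have : Tᶜ.indicator (B q) = Tᶜ.indicator ((hm q).mk _) := by
      ext ω
      by_cases hω : ω ∈ Tᶜ
      · simp only [Set.indicator_of_mem hω, (hsub ω hω).2 q]
      · simp only [Set.indicator_of_notMem hω]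
    rw [this]
    exact (hm q).measurable_mk.indicator hTm.compl
  refine ⟨fun t => Tᶜ.indicator (B t), fun t => ?_, hcont, ?_⟩
  · obtain ⟨u, hu, hlim⟩ := mem_closure_iff_seq_limit.1 (Rat.denseRange_cast (𝕜 := ℝ) t)
    choose q hq using hu
    refine measurable_of_tendsto_metrizable (f := fun n => Tᶜ.indicator (B (u n)))
      (fun n => ?_) ?_
    · rw [← hq n]; exact hrat (q n)
    · exact tendsto_pi_nhds.2 fun ω => ((hcont ω).tendsto t).comp hlim
  · filter_upwards [compl_mem_ae_iff.2 hT0] with ω hω t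
    rw [Set.indicator_of_mem hω]

end Modification

/-! ### The covariance kernel of fractional Brownian motion -/

section CovarianceKernel

/-- The covariance kernel of fractional Brownian motion. -/
noncomputable def fbmCov (H v s t : ℝ) : ℝ :=
  v / 2 * (|s| ^ (2 * H) + |t| ^ (2 * H) - |s - t| ^ (2 * H))

/-- The variance of the integral of fractional Brownian motion against the weight `a`. -/
noncomputable def fbmIntegralVar (H v : ℝ) (a : ℝ → ℝ) : ℝ :=
  ∫ s, (∫ t, fbmCov H v s t * a t) * a s

lemma continuous_fbmCov {H : ℝ} (hH : 0 < H) (v : ℝ) :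
    Continuous fun p : ℝ × ℝ => fbmCov H v p.1 p.2 := by
  unfold fbmCov
  have h : Continuous fun x : ℝ => |x| ^ (2 * H) :=
    continuous_abs.rpow_const fun x => Or.inr (by positivity)
  exact continuous_const.mul (((h.comp continuous_fst).add (h.comp continuous_snd)).sub
    (h.comp (continuous_fst.sub continuous_snd)))

lemma abs_rpow_two_mul (H x : ℝ) : |x| ^ (2 * H) = (|x| ^ H) ^ 2 := by
  rw [mul_comm, Real.rpow_mul (abs_nonneg x), ← Real.rpow_natCast]
  norm_num

lemma fbmCov_self {H : ℝ} (hH : 0 < H) (v s : ℝ) : fbmCov H v s s = v * (|s| ^ H) ^ 2 := by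
  rw [fbmCov, sub_self, abs_zero, Real.zero_rpow (by positivity), abs_rpow_two_mul]
  ring

lemma fbmCov_scale (H v s t : ℝ) {c : ℝ} (hc : 0 < c) :
    fbmCov H v (c * s) (c * t) = c ^ (2 * H) * fbmCov H v s t := by
  simp only [fbmCov]
  rw [← mul_sub, abs_mul, abs_mul, abs_mul, abs_of_pos hc, Real.mul_rpow hc.le (abs_nonneg _),
    Real.mul_rpow hc.le (abs_nonneg _), Real.mul_rpow hc.le (abs_nonneg _)]
  ring

/-- Stationarity of increments: the correction splits into a function of `s` and a function of `t`,
which vanish against weights of integral zero. -/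
lemma fbmCov_translate (H v k s t : ℝ) :
    fbmCov H v (k + s) (k + t) = fbmCov H v s t + (fbmCov H v (k + s) k - v / 2 * |k| ^ (2 * H)) +
      (fbmCov H v (k + t) k - v / 2 * |k| ^ (2 * H)) := by
  simp only [fbmCov, add_sub_cancel_left, add_sub_add_left_eq_sub]
  ring

variable {Ω : Type*} [MeasurableSpace Ω] {P : Measure Ω} {H v : ℝ} {B : ℝ → Ω → ℝ}

namespace IsFractionalBrownianMotion

lemma congr {B' : ℝ → Ω → ℝ} (hB : IsFractionalBrownianMotion H v B P)
    (h : ∀ᵐ ω ∂P, ∀ t, B t ω = B' t ω) : IsFractionalBrownianMotion H v B' P where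
  isGaussianProcess := hB.isGaussianProcess.congr fun t => h.mono fun ω hω => hω t
  mean_eq_zero t := by
    rw [← hB.mean_eq_zero t]
    exact integral_congr_ae (h.mono fun ω hω => (hω t).symm)
  covariance_eq s t := by
    have e : ∀ t, B t =ᵐ[P] B' t := fun t => h.mono fun ω hω => hω t
    rw [← hB.covariance_eq s t, covariance, covariance, integral_congr_ae (e s),
      integral_congr_ae (e t)]
    refine integral_congr_ae ?_
    filter_upwards [e s, e t] with ω h1 h2
    rw [h1, h2]
  continuous_paths := by
    filter_upwards [h, hB.continuous_paths] with ω h1 h2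
    simpa only [h1] using h2

lemma isProbabilityMeasure (hB : IsFractionalBrownianMotion H v B P) : IsProbabilityMeasure P :=
  hB.isGaussianProcess.isProbabilityMeasure

lemma aemeasurable (hB : IsFractionalBrownianMotion H v B P) (t : ℝ) : AEMeasurable (B t) P :=
  hB.isGaussianProcess.aemeasurable t

lemma memLp_two (hB : IsFractionalBrownianMotion H v B P) (t : ℝ) : MemLp (B t) 2 P :=
  (hB.isGaussianProcess.hasGaussianLaw_eval t).memLp_two

lemma variance_eq (hB : IsFractionalBrownianMotion H v B P) (hH : 0 < H) (t : ℝ) :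
    Var[B t; P] = v * (|t| ^ H) ^ 2 := by
  rw [← covariance_self (hB.aemeasurable t), ← fbmCov_self hH]
  exact hB.covariance_eq t t

lemma scale_nonneg (hB : IsFractionalBrownianMotion H v B P) (hH : 0 < H) : 0 ≤ v := by
  have := variance_nonneg (B 1) P
  rw [hB.variance_eq hH 1] at this
  simpa using this

/-- Cauchy–Schwarz for the process itself; the product form makes the kernel integrable against two
copies of the weight. -/
lemma abs_fbmCov_le (hB : IsFractionalBrownianMotion H v B P) (hH : 0 < H) (s t : ℝ) :
    |fbmCov H v s t| ≤ v * (|s| ^ H * |t| ^ H) := by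
  have := hB.isProbabilityMeasure
  have hv := hB.scale_nonneg hH
  have h := covariance_sq_le (hB.memLp_two s) (hB.memLp_two t)
  rw [hB.variance_eq hH, hB.variance_eq hH, hB.covariance_eq] at h
  refine abs_le_of_sq_le_sq ?_ (by positivity)
  calc fbmCov H v s t ^ 2 ≤ v * (|s| ^ H) ^ 2 * (v * (|t| ^ H) ^ 2) := h
    _ = _ := by ring

lemma integral_abs_sub_le (hB : IsFractionalBrownianMotion H v B P) (hH : 0 < H) (s t : ℝ) :
    ∫ ω, |B s ω - B t ω| ∂P ≤ √v * |s - t| ^ H := by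
  have := hB.isProbabilityMeasure
  have hm : MemLp (fun ω => B s ω - B t ω) 2 P := (hB.memLp_two s).sub (hB.memLp_two t)
  -- Nonnegativity of this variance bounds the first absolute moment by the root of the second.
  have h1 := variance_nonneg |fun ω => B s ω - B t ω| P
  rw [variance_eq_sub hm.abs] at h1
  have h2 : Var[fun ω => B s ω - B t ω; P] = v * (|s - t| ^ H) ^ 2 := by
    rw [variance_fun_sub (hB.memLp_two s) (hB.memLp_two t), hB.variance_eq hH, hB.variance_eq hH,
      hB.covariance_eq, abs_rpow_two_mul, abs_rpow_two_mul, abs_rpow_two_mul]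
    ring
  rw [variance_eq_sub hm, integral_sub ((hB.memLp_two s).integrable one_le_two)
    ((hB.memLp_two t).integrable one_le_two), hB.mean_eq_zero, hB.mean_eq_zero] at h2
  simp only [Pi.pow_apply, Pi.abs_apply, sq_abs] at h1 h2
  refine le_of_sq_le_sq ?_ (by positivity)
  rw [mul_pow, Real.sq_sqrt (hB.scale_nonneg hH), ← h2]
  simpa using h1

end IsFractionalBrownianMotion

end CovarianceKernel

/-! ### Discretization of time by simple functions -/

section SimpleFunctionIntegral

lemma integral_comp_simpleFunc_mul (τ : SimpleFunc ℝ ℝ) (g : ℝ → ℝ) {a : ℝ → ℝ}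
    (ha : Integrable a) :
    Integrable (fun t => g (τ t) * a t) ∧
      ∫ t, g (τ t) * a t = ∑ x ∈ τ.range, g x * ∫ t in τ ⁻¹' {x}, a t := by
  have e : ∀ t, g (τ t) * a t = ∑ x ∈ τ.range, (τ ⁻¹' {x}).indicator (fun t => g x * a t) t := by
    intro t
    rw [Finset.sum_eq_single (τ t)]
    · simp
    · intro x _ hx
      exact Set.indicator_of_notMem (fun h => hx (by simpa using h.symm)) _
    · intro h
      exact absurd (τ.mem_range_self t) h
  have hi : ∀ x, Integrable ((τ ⁻¹' {x}).indicator (fun t => g x * a t)) := fun x =>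
    (ha.const_mul (g x)).indicator (τ.measurableSet_preimage {x})
  simp_rw [e]
  refine ⟨integrable_finsetSum _ fun x _ => hi x, ?_⟩
  rw [integral_finsetSum _ fun x _ => hi x]
  refine Finset.sum_congr rfl fun x _ => ?_
  rw [integral_indicator (τ.measurableSet_preimage {x}), integral_const_mul]

/-- Simple functions approximating the identity. -/
noncomputable def approxId (n : ℕ) : SimpleFunc ℝ ℝ :=
  SimpleFunc.approxOn id measurable_id Set.univ 0 (Set.mem_univ 0) n

lemma tendsto_approxId (t : ℝ) : Tendsto (fun n => approxId n t) atTop (𝓝 t) :=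
  SimpleFunc.tendsto_approxOn measurable_id (Set.mem_univ 0) (by simp)

/-- The approximation is never farther from `t` than its base point `0`. This supplies dominating
functions on the whole line, without truncation. -/
lemma abs_approxId_sub_le (n : ℕ) (t : ℝ) : |approxId n t - t| ≤ |t| := by
  have h := SimpleFunc.edist_approxOn_le measurable_id (Set.mem_univ (0 : ℝ)) t n
  rw [edist_dist, edist_dist, ENNReal.ofReal_le_ofReal_iff dist_nonneg] at h
  simpa [Real.dist_eq, approxId] using h

lemma abs_approxId_le (n : ℕ) (t : ℝ) : |approxId n t| ≤ 2 * |t| := by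
  have h1 := abs_approxId_sub_le n t
  have h2 := abs_add_le (approxId n t - t) t
  rw [sub_add_cancel] at h2
  linarith

end SimpleFunctionIntegral

/-! ### Integrable weights -/

section Weights

variable {H : ℝ} {a : ℝ → ℝ}

lemma aestronglyMeasurable_of_integrable_weight (hH : 0 < H)
    (ha : Integrable fun t : ℝ => (1 + |t| ^ H) * a t) : AEStronglyMeasurable a := by
  have hc : Continuous fun t : ℝ => (1 + |t| ^ H)⁻¹ :=
    (continuous_const.add (continuous_abs.rpow_const fun x => Or.inr hH.le)).inv₀
      fun t => (add_pos_of_pos_of_nonneg one_pos (by positivity)).ne'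
  refine (hc.aestronglyMeasurable.mul ha.aestronglyMeasurable).congr (ae_of_all _ fun t => ?_)
  have : (1 + |t| ^ H) ≠ 0 := by positivity
  simp only [Pi.mul_apply]
  field_simp

lemma integrable_of_integrable_weight (hH : 0 < H)
    (ha : Integrable fun t : ℝ => (1 + |t| ^ H) * a t) : Integrable a := by
  refine ha.mono (aestronglyMeasurable_of_integrable_weight hH ha) (ae_of_all _ fun t => ?_)
  rw [norm_mul, Real.norm_of_nonneg (by positivity : 0 ≤ 1 + |t| ^ H)]
  have : 0 ≤ |t| ^ H := by positivity
  nlinarith [norm_nonneg (a t)]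

lemma integrable_rpow_mul_of_integrable_weight (hH : 0 < H)
    (ha : Integrable fun t : ℝ => (1 + |t| ^ H) * a t) :
    Integrable fun t : ℝ => |t| ^ H * a t := by
  refine (ha.sub (integrable_of_integrable_weight hH ha)).congr (ae_of_all _ fun t => ?_)
  simp only [Pi.sub_apply]
  ring

lemma norm_approxId_sub_rpow_mul_le (hH : 0 < H) (n : ℕ) (t : ℝ) :
    ‖|approxId n t - t| ^ H * |a t|‖ ≤ ‖|t| ^ H * a t‖ := by
  rw [Real.norm_of_nonneg (by positivity), norm_mul, Real.norm_of_nonneg (by positivity)]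
  exact mul_le_mul_of_nonneg_right
    (Real.rpow_le_rpow (abs_nonneg _) (abs_approxId_sub_le n t) hH.le) (abs_nonneg _)

lemma aestronglyMeasurable_approxId_sub_rpow_mul (ha : AEStronglyMeasurable a) (n : ℕ) :
    AEStronglyMeasurable fun t => |approxId n t - t| ^ H * |a t| :=
  ((((approxId n).measurable.sub measurable_id).abs.pow_const H).aestronglyMeasurable).mul ha.norm

end Weights

/-! ### Discretized path integrals and their convergence in mean -/

namespace IsFractionalBrownianMotion

variable {Ω : Type*} [MeasurableSpace Ω] {P : Measure Ω} {H v : ℝ} {B : ℝ → Ω → ℝ} {a : ℝ → ℝ}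

/-- The integrand in the double integral of the covariance kernel, discretized by `τ`. -/
lemma integrable_fbmCov_comp_mul (hB : IsFractionalBrownianMotion H v B P) (hH : 0 < H)
    (ha : Integrable fun t : ℝ => (1 + |t| ^ H) * a t) {τ : ℝ → ℝ} (hτ : Measurable τ)
    (hb : ∀ t, |τ t| ≤ 2 * |t|) :
    Integrable (fun p : ℝ × ℝ => fbmCov H v (τ p.1) (τ p.2) * a p.2 * a p.1)
        (volume.prod volume) ∧
      ∀ p : ℝ × ℝ, ‖fbmCov H v (τ p.1) (τ p.2) * a p.2 * a p.1‖ ≤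
        v * 2 ^ H * 2 ^ H * ‖|p.1| ^ H * a p.1 * (|p.2| ^ H * a p.2)‖ := by
  have hv := hB.scale_nonneg hH
  have hbound : ∀ p : ℝ × ℝ, ‖fbmCov H v (τ p.1) (τ p.2) * a p.2 * a p.1‖ ≤
        v * 2 ^ H * 2 ^ H * ‖|p.1| ^ H * a p.1 * (|p.2| ^ H * a p.2)‖ := by
    intro p
    have h1 : ∀ t, |τ t| ^ H ≤ 2 ^ H * |t| ^ H := fun t => by
      rw [← Real.mul_rpow (by norm_num) (abs_nonneg t)]
      exact Real.rpow_le_rpow (abs_nonneg _) (hb t) hH.le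
    have h2 : |fbmCov H v (τ p.1) (τ p.2)| ≤ v * ((2 ^ H * |p.1| ^ H) * (2 ^ H * |p.2| ^ H)) :=
      (hB.abs_fbmCov_le hH _ _).trans (by gcongr <;> exact h1 _)
    simp only [Real.norm_eq_abs, abs_mul, abs_of_nonneg (Real.rpow_nonneg (abs_nonneg p.1) H),
      abs_of_nonneg (Real.rpow_nonneg (abs_nonneg p.2) H)]
    calc _ ≤ v * ((2 ^ H * |p.1| ^ H) * (2 ^ H * |p.2| ^ H)) * |a p.2| * |a p.1| := by gcongr
      _ = _ := by ring
  refine ⟨?_, hbound⟩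
  have hr := integrable_rpow_mul_of_integrable_weight hH ha
  have hm := aestronglyMeasurable_of_integrable_weight hH ha
  refine (((hr.mul_prod hr).norm).const_mul (v * 2 ^ H * 2 ^ H)).mono' ?_ (ae_of_all _ hbound)
  have hK : Measurable fun p : ℝ × ℝ => fbmCov H v (τ p.1) (τ p.2) :=
    (continuous_fbmCov hH v).measurable.comp
      ((hτ.comp measurable_fst).prodMk (hτ.comp measurable_snd))
  exact (hK.aestronglyMeasurable.mul hm.comp_snd).mul hm.comp_fst

/-- Dominated convergence on the plane: the kernel is continuous, and the product bound survives
discretization up to a constant. -/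
lemma tendsto_fbmCov_approxId (hB : IsFractionalBrownianMotion H v B P) (hH : 0 < H)
    (ha : Integrable fun t : ℝ => (1 + |t| ^ H) * a t) :
    Tendsto (fun n => ∫ s, (∫ t, fbmCov H v (approxId n s) (approxId n t) * a t) * a s) atTop
      (𝓝 (fbmIntegralVar H v a)) := by
  have e : ∀ τ : ℝ → ℝ, Measurable τ → (∀ t, |τ t| ≤ 2 * |t|) →
      ∫ s, (∫ t, fbmCov H v (τ s) (τ t) * a t) * a s =
        ∫ p : ℝ × ℝ, fbmCov H v (τ p.1) (τ p.2) * a p.2 * a p.1 ∂(volume.prod volume) := by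
    intro τ hτ hb
    rw [integral_prod _ (hB.integrable_fbmCov_comp_mul hH ha hτ hb).1]
    simp_rw [integral_mul_const]
  have e0 := e id measurable_id fun t => by have := abs_nonneg t; simp only [id]; linarith
  simp only [id] at e0
  rw [fbmIntegralVar, e0]
  simp_rw [fun n => e (approxId n) (approxId n).measurable (abs_approxId_le n)]
  have hr := integrable_rpow_mul_of_integrable_weight hH ha
  refine tendsto_integral_of_dominated_convergence _ (fun n =>
    (hB.integrable_fbmCov_comp_mul hH ha (approxId n).measurable
      (abs_approxId_le n)).1.aestronglyMeasurable)
    (((hr.mul_prod hr).norm).const_mul (v * 2 ^ H * 2 ^ H)) (fun n => ae_of_all _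
    (hB.integrable_fbmCov_comp_mul hH ha (approxId n).measurable (abs_approxId_le n)).2)
    (ae_of_all _ fun p => ?_)
  exact ((((continuous_fbmCov hH v).tendsto p).comp
    ((tendsto_approxId p.1).prodMk_nhds (tendsto_approxId p.2))).mul_const _).mul_const _

/-- The integral of the discretized path is a normal variable. -/
lemma map_integral_approxId (hB : IsFractionalBrownianMotion H v B P)
    (ha : Integrable a) (n : ℕ) :
    0 ≤ (∫ s, (∫ t, fbmCov H v (approxId n s) (approxId n t) * a t) * a s) ∧
    P.map (fun ω => ∫ t, B (approxId n t) ω * a t) = gaussianReal 0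
      (∫ s, (∫ t, fbmCov H v (approxId n s) (approxId n t) * a t) * a s).toNNReal := by
  have := hB.isProbabilityMeasure
  set τ := approxId n
  let c (x : ℝ) : ℝ := ∫ t in τ ⁻¹' {x}, a t
  have hd : (fun ω => ∫ t, B (τ t) ω * a t) = fun ω => ∑ x ∈ τ.range, c x • B x ω := by
    ext ω
    rw [(integral_comp_simpleFunc_mul τ (fun x => B x ω) ha).2]
    exact Finset.sum_congr rfl fun x _ => mul_comm _ _
  have hG : HasGaussianLaw (fun ω => ∑ x ∈ τ.range, c x • B x ω) P :=
    (hB.isGaussianProcess.smul c).hasGaussianLaw_fun_sum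
  have hmem : ∀ x ∈ τ.range, MemLp (fun ω => c x • B x ω) 2 P := fun x _ =>
    (hB.memLp_two x).const_smul (c x)
  have hmean : ∫ ω, ∑ x ∈ τ.range, c x • B x ω ∂P = 0 := by
    rw [integral_finsetSum _ fun x hx => (hmem x hx).integrable one_le_two]
    simp [integral_const_mul, hB.mean_eq_zero]
  -- The finite double sum of covariances is the double integral of the discretized kernel.
  have hvar : Var[fun ω => ∑ x ∈ τ.range, c x • B x ω; P] =
      ∫ s, (∫ t, fbmCov H v (τ s) (τ t) * a t) * a s := by
    rw [← covariance_self hG.aemeasurable, covariance_fun_sum_fun_sum' hmem hmem,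
      (integral_comp_simpleFunc_mul τ (fun x => ∫ t, fbmCov H v x (τ t) * a t) ha).2]
    refine Finset.sum_congr rfl fun x _ => ?_
    rw [(integral_comp_simpleFunc_mul τ (fun y => fbmCov H v x y) ha).2, Finset.sum_mul]
    refine Finset.sum_congr rfl fun y _ => ?_
    simp only [smul_eq_mul]
    rw [covariance_const_mul_left, covariance_const_mul_right, hB.covariance_eq]
    simp only [c, fbmCov]
    ring
  rw [hd, hG.map_eq_gaussianReal, hmean, hvar]
  exact ⟨hvar ▸ variance_nonneg _ _, rfl⟩

section ContinuousVersion

variable (hB : IsFractionalBrownianMotion H v B P) (hH : 0 < H)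
  (hm : ∀ t, Measurable (B t)) (hc : ∀ ω, Continuous fun t => B t ω)
  (ha : Integrable fun t : ℝ => (1 + |t| ^ H) * a t)

include hB hH hm hc ha

/-- Integrating over `ω` first, the increment bound reduces everything to an integral in `t`. Path
continuity provides the joint measurability. -/
lemma integrable_approxId_sub (n : ℕ) :
    Integrable (fun p : Ω × ℝ => (B (approxId n p.2) p.1 - B p.2 p.1) * a p.2) (P.prod volume) ∧
      ∫ p, ‖(B (approxId n p.2) p.1 - B p.2 p.1) * a p.2‖ ∂(P.prod volume) ≤
        √v * ∫ t, |approxId n t - t| ^ H * |a t| := by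
  have := hB.isProbabilityMeasure
  have hBm : Measurable (Function.uncurry B) := measurable_uncurry_of_continuous_of_measurable hc hm
  have ham := aestronglyMeasurable_of_integrable_weight hH ha
  have hf1 : Measurable fun p : Ω × ℝ => B (approxId n p.2) p.1 - B p.2 p.1 :=
    (hBm.comp (((approxId n).measurable.comp measurable_snd).prodMk measurable_fst)).sub
      (hBm.comp (measurable_snd.prodMk measurable_fst))
  have hf : AEStronglyMeasurable
      (fun p : Ω × ℝ => (B (approxId n p.2) p.1 - B p.2 p.1) * a p.2) (P.prod volume) :=
    hf1.aestronglyMeasurable.mul ham.comp_snd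
  have hi : Integrable (fun t => √v * (|approxId n t - t| ^ H * |a t|)) := by
    exact ((integrable_rpow_mul_of_integrable_weight hH ha).mono
      (aestronglyMeasurable_approxId_sub_rpow_mul ham n)
      (ae_of_all _ (norm_approxId_sub_rpow_mul_le hH n))).const_mul _
  have hle : ∀ t, ∫ ω, ‖(B (approxId n t) ω - B t ω) * a t‖ ∂P ≤
      √v * (|approxId n t - t| ^ H * |a t|) := by
    intro t
    simp_rw [norm_mul, Real.norm_eq_abs]
    rw [integral_mul_const, ← mul_assoc]
    gcongr
    exact hB.integral_abs_sub_le hH _ _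
  have hint : Integrable (fun p : Ω × ℝ => (B (approxId n p.2) p.1 - B p.2 p.1) * a p.2)
      (P.prod volume) := by
    rw [integrable_prod_iff' hf]
    refine ⟨ae_of_all _ fun t => ?_, ?_⟩
    · exact (((hB.memLp_two (approxId n t)).sub (hB.memLp_two t)).integrable one_le_two).mul_const
        (a t)
    · refine hi.mono' hf.norm.prod_swap.integral_prod_right' (ae_of_all _ fun t => ?_)
      rw [Real.norm_of_nonneg (integral_nonneg fun ω => norm_nonneg _)]
      exact hle t
  refine ⟨hint, ?_⟩
  rw [integral_prod_symm _ hint.norm, ← integral_const_mul]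
  refine integral_mono_of_nonneg (ae_of_all _ fun t => integral_nonneg fun ω => norm_nonneg _) hi
    (ae_of_all _ hle)

lemma tendsto_integral_abs_approxId_sub :
    Tendsto (fun n => ∫ ω, |(∫ t, B (approxId n t) ω * a t) - ∫ t, B t ω * a t| ∂P) atTop
      (𝓝 0) := by
  have := hB.isProbabilityMeasure
  have hai := integrable_of_integrable_weight hH ha
  have ham := hai.aestronglyMeasurable
  have hlim : Tendsto (fun n => √v * ∫ t, |approxId n t - t| ^ H * |a t|) atTop (𝓝 0) := by
    have h : Tendsto (fun n => ∫ t, |approxId n t - t| ^ H * |a t|) atTop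
        (𝓝 (∫ t : ℝ, (0 : ℝ))) := by
      refine tendsto_integral_of_dominated_convergence _
        (aestronglyMeasurable_approxId_sub_rpow_mul ham)
        (integrable_rpow_mul_of_integrable_weight hH ha).norm
        (fun n => ae_of_all _ (norm_approxId_sub_rpow_mul_le hH n)) (ae_of_all _ fun t => ?_)
      have h1 : Tendsto (fun n => |approxId n t - t|) atTop (𝓝 0) := by
        simpa using ((tendsto_approxId t).sub_const t).abs
      have h2 := (h1.rpow_const (p := H) (Or.inr hH.le)).mul_const |a t|
      rwa [Real.zero_rpow hH.ne', zero_mul] at h2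
    rw [integral_zero] at h
    simpa using h.const_mul √v
  refine squeeze_zero (fun n => integral_nonneg fun ω => abs_nonneg _) (fun n => ?_) hlim
  obtain ⟨h1, h2⟩ := integrable_approxId_sub hB hH hm hc ha n
  refine le_trans ?_ h2
  rw [integral_prod _ h1.norm]
  refine integral_mono_of_nonneg (ae_of_all _ fun ω => abs_nonneg _) h1.integral_norm_prod_left ?_
  filter_upwards [h1.prod_right_ae] with ω hω
  have hs := (integral_comp_simpleFunc_mul (approxId n) (fun x => B x ω) hai).1
  -- Integrability along almost every path is obtained as that of the discretized integrand minus
  -- the difference.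
  have hBi : Integrable fun t => B t ω * a t := by
    refine (hs.sub hω).congr (ae_of_all _ fun t => ?_)
    simp only [Pi.sub_apply]
    ring
  rw [← integral_sub hs hBi]
  refine (abs_integral_le_integral_abs).trans (le_of_eq ?_)
  simp only [Real.norm_eq_abs, sub_mul]

lemma aestronglyMeasurable_integral_mul :
    AEStronglyMeasurable (fun ω => ∫ t, B t ω * a t) P := by
  have := hB.isProbabilityMeasure
  have hBm : Measurable (Function.uncurry B) := measurable_uncurry_of_continuous_of_measurable hc hm
  have ham := aestronglyMeasurable_of_integrable_weight hH ha
  have h : AEStronglyMeasurable (fun p : Ω × ℝ => B p.2 p.1 * a p.2) (P.prod volume) :=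
    (hBm.comp (measurable_snd.prodMk measurable_fst)).aestronglyMeasurable.mul ham.comp_snd
  exact h.integral_prod_right'

end ContinuousVersion

end IsFractionalBrownianMotion

/-! ### Characteristic functions and convergence in mean -/

section CharFun

/-- The map `x ↦ exp (i * u * x)` is Lipschitz with constant `|u|`. -/
lemma norm_charFun_map_sub_le {Ω : Type*} [MeasurableSpace Ω] {P : Measure Ω}
    [IsProbabilityMeasure P] {X Y : Ω → ℝ} (hX : AEMeasurable X P) (hY : AEMeasurable Y P)
    (hi : Integrable (fun ω => X ω - Y ω) P) (u : ℝ) :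
    ‖charFun (P.map X) u - charFun (P.map Y) u‖ ≤ |u| * ∫ ω, |X ω - Y ω| ∂P := by
  have e : ∀ {X : Ω → ℝ}, AEMeasurable X P →
      charFun (P.map X) u = ∫ ω, Complex.exp (Complex.I * ((u * X ω : ℝ) : ℂ)) ∂P ∧
      Integrable (fun ω => Complex.exp (Complex.I * ((u * X ω : ℝ) : ℂ))) P := by
    intro X hX
    constructor
    · rw [charFun_apply_real, integral_map hX (by fun_prop)]
      congr 1
      ext ω
      congr 1
      push_cast
      ring
    · refine Integrable.of_bound (C := 1) ?_ (ae_of_all _ fun ω => ?_)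
      · exact (Complex.measurable_exp.comp_aemeasurable
          (Complex.measurable_ofReal.comp_aemeasurable
            (hX.const_mul u) |>.const_mul Complex.I)).aestronglyMeasurable
      · rw [Complex.norm_exp_I_mul_ofReal]
  rw [(e hX).1, (e hY).1, ← integral_sub (e hX).2 (e hY).2, ← integral_const_mul]
  refine (norm_integral_le_integral_norm _).trans
    (integral_mono ((e hX).2.sub (e hY).2).norm (hi.abs.const_mul _) fun ω => ?_)
  have h1 : Complex.exp (Complex.I * ((u * X ω : ℝ) : ℂ)) -
      Complex.exp (Complex.I * ((u * Y ω : ℝ) : ℂ)) =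
      Complex.exp (Complex.I * ((u * Y ω : ℝ) : ℂ)) *
        (Complex.exp (Complex.I * ((u * (X ω - Y ω) : ℝ) : ℂ)) - 1) := by
    rw [mul_sub, mul_one, ← Complex.exp_add]
    congr 2
    push_cast
    ring
  simp only
  rw [h1, norm_mul, Complex.norm_exp_I_mul_ofReal, one_mul, ← abs_mul]
  exact Real.norm_exp_I_mul_ofReal_sub_one_le

end CharFun

/-! ### Normality of path integrals -/

section IntegralLaw

variable {Ω : Type*} [MeasurableSpace Ω] {P : Measure Ω} {H v : ℝ} {B : ℝ → Ω → ℝ} {a : ℝ → ℝ}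

namespace IsFractionalBrownianMotion

lemma map_integral_mul_of_continuous (hB : IsFractionalBrownianMotion H v B P) (hH : 0 < H)
    (hm : ∀ t, Measurable (B t)) (hc : ∀ ω, Continuous fun t => B t ω)
    (ha : Integrable fun t : ℝ => (1 + |t| ^ H) * a t) :
    0 ≤ fbmIntegralVar H v a ∧ P.map (fun ω => ∫ t, B t ω * a t) =
      gaussianReal 0 (fbmIntegralVar H v a).toNNReal := by
  have := hB.isProbabilityMeasure
  have hai := integrable_of_integrable_weight hH ha
  have hV := hB.tendsto_fbmCov_approxId hH ha
  have hV0 : 0 ≤ fbmIntegralVar H v a :=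
    ge_of_tendsto' hV fun n => (hB.map_integral_approxId hai n).1
  have hdm := (hB.aestronglyMeasurable_integral_mul hH hm hc ha).aemeasurable
  have hE := hB.tendsto_integral_abs_approxId_sub hH hm hc ha
  have hnm : ∀ n, AEMeasurable (fun ω => ∫ t, B (approxId n t) ω * a t) P := by
    intro n
    simp_rw [fun ω => (integral_comp_simpleFunc_mul (approxId n) (fun x => B x ω) hai).2]
    exact (Finset.measurable_fun_sum _ fun x _ => (hm x).mul_const _).aemeasurable
  have hdi : ∀ n, Integrable (fun ω => (∫ t, B (approxId n t) ω * a t) - ∫ t, B t ω * a t) P := by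
    intro n
    refine (hB.integrable_approxId_sub hH hm hc ha n).1.integral_prod_left.congr ?_
    filter_upwards [(hB.integrable_approxId_sub hH hm hc ha n).1.prod_right_ae] with ω hω
    have hs := (integral_comp_simpleFunc_mul (approxId n) (fun x => B x ω) hai).1
    have hBi : Integrable fun t => B t ω * a t := by
      refine (hs.sub hω).congr (ae_of_all _ fun t => ?_)
      simp only [Pi.sub_apply]
      ring
    rw [← integral_sub hs hBi]
    simp only [sub_mul]
  refine ⟨hV0, ?_⟩
  have := Measure.isProbabilityMeasure_map hdm
  refine Measure.ext_of_charFun (funext fun u => ?_)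
  have h1 : Tendsto (fun n => charFun (P.map fun ω => ∫ t, B (approxId n t) ω * a t) u) atTop
      (𝓝 (charFun (P.map fun ω => ∫ t, B t ω * a t) u)) := by
    rw [tendsto_iff_norm_sub_tendsto_zero]
    exact squeeze_zero (fun n => norm_nonneg _)
      (fun n => norm_charFun_map_sub_le (hnm n) hdm (hdi n) u) (by simpa using hE.const_mul |u|)
  refine tendsto_nhds_unique h1 ?_
  simp_rw [fun n => (hB.map_integral_approxId hai n).2, charFun_gaussianReal]
  have h2 : ∀ n, (((∫ s, (∫ t, fbmCov H v (approxId n s) (approxId n t) * a t) * a s).toNNReal : ℝ)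
      : ℂ) = ((∫ s, (∫ t, fbmCov H v (approxId n s) (approxId n t) * a t) * a s : ℝ) : ℂ) :=
    fun n => by rw [Real.coe_toNNReal _ (hB.map_integral_approxId hai n).1]
  have h3 : (((fbmIntegralVar H v a).toNNReal : ℝ) : ℂ) = (fbmIntegralVar H v a : ℂ) := by
    rw [Real.coe_toNNReal _ hV0]
  simp_rw [h2, h3]
  have h4 := (Complex.continuous_ofReal.tendsto _).comp hV
  exact (Complex.continuous_exp.tendsto _).comp
    (((h4.mul_const _).div_const _).const_sub _)

/-- The integral of fractional Brownian motion against a weight is a centred normal variable. -/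
theorem map_integral_mul (hB : IsFractionalBrownianMotion H v B P) (hH : 0 < H)
    (ha : Integrable fun t : ℝ => (1 + |t| ^ H) * a t) :
    AEMeasurable (fun ω => ∫ t, B t ω * a t) P ∧ 0 ≤ fbmIntegralVar H v a ∧
      P.map (fun ω => ∫ t, B t ω * a t) = gaussianReal 0 (fbmIntegralVar H v a).toNNReal := by
  obtain ⟨B', hm, hc, h⟩ :=
    exists_measurable_continuous_modification hB.aemeasurable hB.continuous_paths
  have hB' := hB.congr h
  have e : (fun ω => ∫ t, B t ω * a t) =ᵐ[P] fun ω => ∫ t, B' t ω * a t := by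
    filter_upwards [h] with ω hω
    simp only [hω]
  rw [Measure.map_congr e]
  exact ⟨(hB'.aestronglyMeasurable_integral_mul hH hm hc ha).aemeasurable.congr e.symm,
    hB'.map_integral_mul_of_continuous hH hm hc ha⟩

end IsFractionalBrownianMotion

end IntegralLaw

/-! ### Scaling of the coefficient variance -/

section WaveletAtoms

lemma integral_mul_comp_affine (g ψ : ℝ → ℝ) {b : ℝ} (hb : 0 < b) (k : ℝ) :
    ∫ t, g t * ψ (b * (t - k)) = b⁻¹ * ∫ y, g (k + b⁻¹ * y) * ψ y := by
  have h1 := integral_sub_right_eq_self (μ := volume) (fun x => g (k + x) * ψ (b * x)) k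
  simp only [add_sub_cancel] at h1
  have h2 := Measure.integral_comp_mul_left (fun y => g (k + b⁻¹ * y) * ψ y) b
  simp only [inv_mul_cancel_left₀ hb.ne'] at h2
  rw [h1, h2, abs_of_pos (inv_pos.2 hb), smul_eq_mul]

lemma integrable_comp_affine {f : ℝ → ℝ} (hf : Integrable f) {b : ℝ} (hb : 0 < b) (k : ℝ) :
    Integrable fun t => f (b * (t - k)) :=
  (hf.comp_mul_left' hb.ne').comp_sub_right k

variable {H : ℝ} {ψ : ℝ → ℝ}

/-- Subadditivity of `x ↦ x ^ H` bounds the transformed weight by a multiple of the original one. -/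
lemma integrable_weight_affine (hH : 0 < H) (hH1 : H < 1)
    (hψ : Integrable fun t : ℝ => (1 + |t| ^ H) * ψ t) {c : ℝ} (hc : 0 < c) (k : ℝ) :
    Integrable fun y => (1 + |k + c * y| ^ H) * ψ y := by
  have hm := aestronglyMeasurable_of_integrable_weight hH hψ
  have hw : Continuous fun y : ℝ => 1 + |k + c * y| ^ H :=
    continuous_const.add ((continuous_abs.comp (by fun_prop)).rpow_const fun x => Or.inr hH.le)
  refine (hψ.const_mul (1 + |k| ^ H + c ^ H)).mono (hw.aestronglyMeasurable.mul hm)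
    (ae_of_all _ fun y => ?_)
  have hk : 0 ≤ |k| ^ H := by positivity
  have hcH : 0 ≤ c ^ H := by positivity
  have hy : 0 ≤ |y| ^ H := by positivity
  have hs : |k + c * y| ^ H ≤ |k| ^ H + c ^ H * |y| ^ H := by
    calc |k + c * y| ^ H ≤ (|k| + |c * y|) ^ H :=
          Real.rpow_le_rpow (abs_nonneg _) (abs_add_le _ _) hH.le
      _ ≤ |k| ^ H + |c * y| ^ H :=
          Real.rpow_add_le_add_rpow (abs_nonneg _) (abs_nonneg _) hH.le hH1.le
      _ = _ := by rw [abs_mul, abs_of_pos hc, Real.mul_rpow hc.le (abs_nonneg _)]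
  have key : 1 + |k + c * y| ^ H ≤ (1 + |k| ^ H + c ^ H) * (1 + |y| ^ H) := by
    nlinarith [mul_nonneg hk hy]
  rw [norm_mul, ← mul_assoc, norm_mul,
    Real.norm_of_nonneg (by positivity : 0 ≤ 1 + |k + c * y| ^ H),
    Real.norm_of_nonneg (mul_nonneg (by linarith) (by linarith))]
  exact mul_le_mul_of_nonneg_right key (norm_nonneg _)

lemma integrable_weight_ndwtAtom (hH : 0 < H) (hH1 : H < 1)
    (hψ : Integrable fun t : ℝ => (1 + |t| ^ H) * ψ t) (j : ℤ) (k : ℝ) :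
    Integrable fun t : ℝ => (1 + |t| ^ H) * ndwtAtom ψ j k t := by
  have hb : (0 : ℝ) < (2 : ℝ) ^ j := by positivity
  have h := (integrable_comp_affine (integrable_weight_affine hH hH1 hψ (inv_pos.2 hb) k)
    hb k).const_mul ((2 : ℝ) ^ ((j : ℝ) / 2))
  refine h.congr (ae_of_all _ fun t => ?_)
  simp only [ndwtAtom, inv_mul_cancel_left₀ hb.ne', add_sub_cancel]
  ring

lemma integral_mul_ndwtAtom (g ψ : ℝ → ℝ) (j : ℤ) (k : ℝ) :
    ∫ t, g t * ndwtAtom ψ j k t = (2 : ℝ) ^ ((j : ℝ) / 2) * ((2 : ℝ) ^ j)⁻¹ *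
      ∫ y, g (k + ((2 : ℝ) ^ j)⁻¹ * y) * ψ y := by
  have := integral_mul_comp_affine g ψ (b := (2 : ℝ) ^ j) (by positivity) k
  rw [mul_assoc, ← this, ← integral_const_mul]
  congr 1
  ext t
  simp only [ndwtAtom]
  ring

/-- The variance of a wavelet coefficient at level `j` is that at level `0` times a constant that
depends on `j` and `H` only. -/
lemma IsFractionalBrownianMotion.fbmIntegralVar_ndwtAtom {Ω : Type*} [MeasurableSpace Ω]
    {P : Measure Ω} {v : ℝ} {B : ℝ → Ω → ℝ} (hB : IsFractionalBrownianMotion H v B P)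
    (hH : 0 < H) (hH1 : H < 1) (hψ : Integrable fun t : ℝ => (1 + |t| ^ H) * ψ t)
    (hψ0 : ∫ t, ψ t = 0) (j : ℤ) (k : ℝ) :
    fbmIntegralVar H v (ndwtAtom ψ j k) = ((2 : ℝ) ^ ((j : ℝ) / 2) * ((2 : ℝ) ^ j)⁻¹) ^ 2 *
      ((2 : ℝ) ^ j)⁻¹ ^ (2 * H) * fbmIntegralVar H v ψ := by
  set c : ℝ := ((2 : ℝ) ^ j)⁻¹
  have hc : 0 < c := by positivity
  have hψi := integrable_of_integrable_weight hH hψ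
  have hψr := integrable_rpow_mul_of_integrable_weight hH hψ
  have hcov : Continuous fun p : ℝ × ℝ => fbmCov H v p.1 p.2 := continuous_fbmCov hH v
  let g (y : ℝ) : ℝ := fbmCov H v (k + c * y) k - v / 2 * |k| ^ (2 * H)
  -- Only the first term survives: `g t` vanishes in the integral against `ψ s`, and `g s` in that
  -- against `ψ t`.
  have hK : ∀ s t, fbmCov H v (k + c * s) (k + c * t) =
      c ^ (2 * H) * fbmCov H v s t + g s + g t := by
    intro s t
    rw [fbmCov_translate, fbmCov_scale _ _ _ _ hc]
  have hcovi : ∀ s, Integrable fun t => fbmCov H v s t * ψ t := by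
    intro s
    refine (hψr.norm.const_mul (v * |s| ^ H)).mono'
      ((hcov.comp (by fun_prop : Continuous fun t : ℝ => (s, t))).aestronglyMeasurable.mul
        hψi.aestronglyMeasurable) (ae_of_all _ fun t => ?_)
    rw [norm_mul, norm_mul, Real.norm_eq_abs, Real.norm_eq_abs, Real.norm_eq_abs,
      abs_of_nonneg (by positivity : 0 ≤ |t| ^ H)]
    calc _ ≤ v * (|s| ^ H * |t| ^ H) * |ψ t| := by
          gcongr
          exact hB.abs_fbmCov_le hH s t
      _ = _ := by ring
  have hgi : Integrable fun t => g t * ψ t := by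
    have hv := hB.scale_nonneg hH
    have hk : 0 ≤ |k| ^ H := by positivity
    have hk2 : 0 ≤ v / 2 * |k| ^ (2 * H) := by positivity
    have hgc : Continuous g :=
      (hcov.comp (by fun_prop : Continuous fun t : ℝ => (k + c * t, k))).sub continuous_const
    refine ((integrable_weight_affine hH hH1 hψ hc k).norm.const_mul
      (v * |k| ^ H + v / 2 * |k| ^ (2 * H))).mono'
      (hgc.aestronglyMeasurable.mul hψi.aestronglyMeasurable) (ae_of_all _ fun t => ?_)
    have hy : 0 ≤ |k + c * t| ^ H := by positivity
    have h1 : |g t| ≤ v * (|k + c * t| ^ H * |k| ^ H) + v / 2 * |k| ^ (2 * H) := by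
      refine (abs_sub _ _).trans ?_
      rw [abs_of_nonneg hk2]
      gcongr
      exact hB.abs_fbmCov_le hH _ _
    rw [norm_mul, norm_mul, Real.norm_of_nonneg (by positivity : 0 ≤ 1 + |k + c * t| ^ H),
      ← mul_assoc]
    refine mul_le_mul_of_nonneg_right (h1.trans ?_) (norm_nonneg _)
    nlinarith [mul_nonneg hv hk, mul_nonneg hk2 hy]
  have hinner : ∀ s, ∫ t, fbmCov H v (k + c * s) (k + c * t) * ψ t =
      c ^ (2 * H) * (∫ t, fbmCov H v s t * ψ t) + ∫ t, g t * ψ t := by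
    intro s
    have e : ∀ t, fbmCov H v (k + c * s) (k + c * t) * ψ t =
        c ^ (2 * H) * (fbmCov H v s t * ψ t) + g s * ψ t + g t * ψ t := by
      intro t
      rw [hK]
      ring
    have i1 : Integrable fun t => c ^ (2 * H) * (fbmCov H v s t * ψ t) + g s * ψ t :=
      ((hcovi s).const_mul _).add (hψi.const_mul _)
    simp_rw [e]
    rw [integral_add i1 hgi, integral_add ((hcovi s).const_mul _) (hψi.const_mul _),
      integral_const_mul, integral_const_mul, hψ0, mul_zero, add_zero]
  have houter : Integrable fun s => (∫ t, fbmCov H v s t * ψ t) * ψ s := by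
    have h := (hB.integrable_fbmCov_comp_mul hH hψ measurable_id fun t => by
      have := abs_nonneg t
      simp only [id]
      linarith).1.integral_prod_left
    simpa only [id, integral_mul_const] using h
  rw [fbmIntegralVar]
  simp_rw [integral_mul_ndwtAtom]
  change (2 : ℝ) ^ ((j : ℝ) / 2) * c * (∫ s, (2 : ℝ) ^ ((j : ℝ) / 2) * c *
    (∫ y, fbmCov H v (k + c * s) (k + c * y) * ψ y) * ψ s) = _
  have e2 : ∀ s, (2 : ℝ) ^ ((j : ℝ) / 2) * c * (∫ y, fbmCov H v (k + c * s) (k + c * y) * ψ y) *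
      ψ s = (2 : ℝ) ^ ((j : ℝ) / 2) * c * (c ^ (2 * H) * ((∫ t, fbmCov H v s t * ψ t) * ψ s) +
        (∫ t, g t * ψ t) * ψ s) := by
    intro s
    rw [hinner]
    ring
  simp_rw [e2]
  rw [integral_const_mul, integral_add (houter.const_mul _) (hψi.const_mul _), integral_const_mul,
    integral_const_mul, hψ0, fbmIntegralVar]
  ring

end WaveletAtoms

/-! ### The theorem -/

lemma ndwtAtom_zero_zero (ψ : ℝ → ℝ) : ndwtAtom ψ 0 0 = ψ := by
  ext x
  simp [ndwtAtom]

theorem mainTheorem5 :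
    -- the numerical value of the constant, to four decimals
    |Real.pi * Real.exp medlQ / (2 * medlQ) - 5.4418| < 0.00005 ∧
    -- the variance is a function `V` of the sample size only
    ∃ V : ℕ → ℝ,
      Asymptotics.IsEquivalent atTop V
        (fun N : ℕ => Real.pi * Real.exp medlQ / (2 * (N : ℝ) * medlQ)) ∧
      ∀ (H : ℝ), 0 < H → H < 1 →
      ∀ (ψ : ℝ → ℝ), Integrable (fun t : ℝ => (1 + |t| ^ H) * ψ t) → ∫ t, ψ t = 0 →
      ∀ (σ : ℝ), 0 < σ →
      ∀ (j : ℤ) (N : ℕ) [NeZero N]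
        {Ω : Type*} [MeasurableSpace Ω] (P : Measure Ω) [IsProbabilityMeasure P]
        -- the `i`-th coefficient of the sample is taken at location `k i` from the path `B i`;
        -- the paths need not be different
        (v : ℝ) (B : Fin N → ℝ → Ω → ℝ) (k : Fin N → ℝ),
        (∀ i, IsFractionalBrownianMotion H v (B i) P) →
        -- `σ ^ 2` is the variance of a coefficient at level `0`
        (∀ i, Var[ndwtCoeff ψ 0 0 (B i); P] = σ ^ 2) →
        iIndepFun (fun i => ndwtCoeff ψ j (k i) (B i)) P →
        MemLp (fun ω => sampleMedian fun i => Real.log (ndwtCoeff ψ j (k i) (B i) ω ^ 2)) 2 P ∧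
        Var[fun ω => sampleMedian fun i => Real.log (ndwtCoeff ψ j (k i) (B i) ω ^ 2); P] =
          V N := by
  refine ⟨abs_medl_constant_sub_lt, medianVariance logSqNormal,
    isEquivalent_medianVariance_logSqNormal, ?_⟩
  intro H hH hH1 ψ hψ hψ0 σ hσ j N _ Ω _ P _ v B k hB hvar hind
  -- The atom at level `0` and location `0` is `ψ` itself; index `0` exists because the sample is
  -- nonempty.
  have hV : fbmIntegralVar H v ψ = σ ^ 2 := by
    obtain ⟨hm, h0, hlaw⟩ := (hB ⟨0, NeZero.pos N⟩).map_integral_mul hH hψ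
    rw [← hvar ⟨0, NeZero.pos N⟩]
    have h := variance_id_map hm
    rw [hlaw, variance_id_gaussianReal, Real.coe_toNNReal _ h0] at h
    have e : ndwtCoeff ψ 0 0 (B ⟨0, NeZero.pos N⟩) =
        fun ω => ∫ t, B ⟨0, NeZero.pos N⟩ t ω * ψ t := by
      ext ω
      simp only [ndwtCoeff, ndwtAtom_zero_zero]
    rw [e]
    exact h
  -- The factor is free of the location, so all coefficients share the positive variance `κ * σ ^
  -- 2`.
  set κ : ℝ := ((2 : ℝ) ^ ((j : ℝ) / 2) * ((2 : ℝ) ^ j)⁻¹) ^ 2 * ((2 : ℝ) ^ j)⁻¹ ^ (2 * H)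
  have hκ : 0 < κ * σ ^ 2 := by positivity
  have hlaw := fun i => (hB i).map_integral_mul hH (integrable_weight_ndwtAtom hH hH1 hψ j (k i))
  refine memLp_and_variance_sampleMedian_log_sq (v := (κ * σ ^ 2).toNNReal)
    (Real.toNNReal_pos.2 hκ).ne' (fun i => (hlaw i).1) (fun i => ?_) hind
  rw [← hV, ← (hB i).fbmIntegralVar_ndwtAtom hH hH1 hψ hψ0 j (k i)]
  exact (hlaw i).2.2
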